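/- Let $\mathbb{D}$ be the open unit disk and $\mathbb{T}$ the unit circle. For $j=1,2$ let $p_j(z)=a_j+b_jz_1+c_jz_2+d_jz_1z_2$ be a polynomial without zeros in $\mathbb{D}^2$ that has no common factor with its reflection $\tilde p_j(z)=\bar a_jz_1z_2+\bar b_jz_2+\bar c_jz_1+\bar d_j$, so that $\theta_j=\tilde p_j/p_j$ is a rational inner function of degree $(1,1)$. Assume that $p_j$ vanishes at a point $(\tau_{1,j},\tau_{2,j})\in\mathbb{T}^2$, and put $\Theta=\theta_1\theta_2$. Let $$\mathcal{S}_{2,\theta_j}=\mathcal{H}\Big(\frac{f_j(z)\overline{f_j(w)}}{1-z_2\bar w_2}\Big)\subseteq H^2(\mathbb{D}^2),\qquad f_j(z)=\frac{\lambda_j(z_2-\tau_{2,j})}{p_j(z)},\quad |\lambda_j|^2=|\bar a_jc_j-d_j\bar b_j|,$$ where $\mathcal{H}(K)$ is the Hilbert space with reproducing kernel $K$. Let $\mathcal{S}_2=\mathcal{S}_{2,\theta_1}\oplus\theta_1\mathcal{S}_{2,\theta_2}$, and let $S^1_\Theta=P_{\mathcal{S}_2}M_{z_1}|_{\mathcal{S}_2}$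 be the compression to $\mathcal{S}_2$ of multiplication by $z_1$, with numerical range $\mathcal{W}(S^1_\Theta)=\{\langle S^1_\Theta h,h\rangle:\|h\|=1\}$. For $z\in\mathbb{T}$ put $$f_{j,z}=\overline{-\frac{b_j+d_jz}{a_j+c_jz}},$$ and let $\beta_j$ be the center of the circle $\big\{-\frac{b_j+d_jz}{a_j+c_jz}:z\in\mathbb{T}\big\}$. If there is $\gamma\in\mathbb{T}\setminus\{\tau_{2,1},\tau_{2,2}\}$ such that either $$|f_{1,\gamma}|+|f_{2,\gamma}|<|1-\overline{f_{1,\gamma}}f_{2,\gamma}|$$ or $$|\bar\beta_j-f_{j,\gamma}|>|\bar\beta_j|\quad\text{for } j=1 \text{ or } j=2,$$ then $0$ lies in the interior of $\mathcal{W}(S^1_\Theta)$. Furthermore, if $j\in\{1,2\}$, $a_j\bar b_j-c_j\bar d_j\in\mathbb{R}$ and $\gamma\in\mathbb{T}\setminus\{\tau_{2,1},\tau_{2,2}\}$, then $|\bar\beta_j-f_{j,\gamma}|>|\bar\beta_j|$ holds if and only if $$|a_jd_j-b_jc_j|>|a_j\bar b_j-c_j\bar d_j|.$$ -/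

import Mathlib

open MeasureTheory ComplexConjugate

noncomputable section

namespace BidiskShift

/-! ### Numerical ranges and compressions of operators on a Hilbert space -/

section Hilbert

variable {H : Type*} [NormedAddCommGroup H] [InnerProductSpace ℂ H]

/-- The numerical range `{⟨T h, h⟩ : ‖h‖ = 1}`.  Mathlib's inner product is linear in the second
variable, so `⟨T h, h⟩`, linear in `T h`, reads `inner ℂ h (T h)`. -/
def numericalRange (T : H →L[ℂ] H) : Set ℂ :=
  {c | ∃ h : H, ‖h‖ = 1 ∧ inner ℂ h (T h) = c}

/-- The compression `P_S T|_S : S → S` of `T` to a closed subspace `S`, where `P_S` is the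
orthogonal projection onto `S`. -/
def compression (T : H →L[ℂ] H) (S : Submodule ℂ H) [S.HasOrthogonalProjection] : S →L[ℂ] S :=
  S.orthogonalProjectionOnto ∘L T ∘L S.subtypeL

end Hilbert

/-! ### The torus, the Hardy space of the bidisk, and multiplication operators -/

/-- The torus `𝕋²`, each circle being parametrised by `ℝ / ℤ`. -/
abbrev Torus : Type := UnitAddCircle × UnitAddCircle

/-- The normalised Lebesgue measure on `𝕋²`. -/
abbrev torusMeasure : Measure Torus :=
  (AddCircle.haarAddCircle (T := (1 : ℝ))).prod (AddCircle.haarAddCircle (T := (1 : ℝ)))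

/-- The Hilbert space `L²(𝕋²)`. -/
abbrev L2Torus : Type := Lp ℂ 2 torusMeasure

/-- The point `z = (z₁, z₂)` of `𝕋² ⊆ ℂ²` with the given parameters. -/
def pt (x : Torus) : ℂ × ℂ := (AddCircle.toCircle x.1, AddCircle.toCircle x.2)

/-- The Fourier coefficient `∫ z₁⁻ᵐ z₂⁻ⁿ F dσ` of `F ∈ L²(𝕋²)`. -/
def fourierCoeffTorus (F : L2Torus) (m n : ℤ) : ℂ :=
  ∫ x : Torus, fourier (-m) x.1 * fourier (-n) x.2 * F x ∂torusMeasure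

lemma integrable_fourier_mul (F : L2Torus) (m n : ℤ) :
    Integrable (fun x : Torus => fourier (-m) x.1 * fourier (-n) x.2 * F x) torusMeasure := by
  have hF : Integrable (fun x => F x) torusMeasure := (Lp.memLp F).integrable (by norm_num)
  refine hF.bdd_mul (c := 1) ?_ ?_
  · exact Continuous.aestronglyMeasurable (by fun_prop)
  · refine Filter.Eventually.of_forall fun x => ?_
    rw [norm_mul, fourier_apply, fourier_apply, Circle.norm_coe, Circle.norm_coe, mul_one]

/-- The Hardy space `H²(𝔻²)`, identified as usual, through boundary values, with the closed
subspace of `L²(𝕋²)` of all functions whose Fourier coefficients vanish off `ℕ × ℕ`. -/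
def hardy : Submodule ℂ L2Torus where
  carrier := {F | ∀ m n : ℤ, m < 0 ∨ n < 0 → fourierCoeffTorus F m n = 0}
  zero_mem' := by
    intro m n _
    unfold fourierCoeffTorus
    refine integral_eq_zero_of_ae ?_
    filter_upwards [Lp.coeFn_zero ℂ 2 torusMeasure] with x hx
    rw [hx, Pi.zero_apply, mul_zero]
  add_mem' := by
    intro F G hF hG m n hmn
    have h : fourierCoeffTorus (F + G) m n = fourierCoeffTorus F m n + fourierCoeffTorus G m n := by
      unfold fourierCoeffTorus
      rw [← integral_add (integrable_fourier_mul F m n) (integrable_fourier_mul G m n)]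
      refine integral_congr_ae ?_
      filter_upwards [Lp.coeFn_add F G] with x hx
      rw [hx, Pi.add_apply, mul_add]
    rw [h, hF m n hmn, hG m n hmn, add_zero]
  smul_mem' := by
    intro c F hF m n hmn
    have h : fourierCoeffTorus (c • F) m n = c * fourierCoeffTorus F m n := by
      unfold fourierCoeffTorus
      rw [← integral_const_mul]
      refine integral_congr_ae ?_
      filter_upwards [Lp.coeFn_smul c F] with x hx
      rw [hx, Pi.smul_apply, smul_eq_mul]
      ring
    rw [h, hF m n hmn, mul_zero]

lemma memLp_z₁ : MemLp (fun x : Torus => (pt x).1) ⊤ torusMeasure := by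
  refine memLp_top_of_bound (Continuous.aestronglyMeasurable ?_) 1 ?_
  · exact continuous_subtype_val.comp (AddCircle.continuous_toCircle.comp continuous_fst)
  · exact Filter.Eventually.of_forall fun x => (Circle.norm_coe _).le

/-- The operator `M_{z₁}` of multiplication by `z₁` on `L²(𝕋²)`; it leaves `H²(𝔻²)` invariant. -/
def Mz₁ : L2Torus →L[ℂ] L2Torus :=
  (ContinuousLinearMap.mul ℂ ℂ).holderL torusMeasure ⊤ 2 2 (memLp_z₁.toLp _)

/-- `φ S = {φ G : G ∈ S}`, for a function `φ` on `ℂ²` and a subspace `S` of `L²(𝕋²)`. -/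
def mulSubspace (φ : ℂ × ℂ → ℂ) (S : Submodule ℂ L2Torus) : Submodule ℂ L2Torus where
  carrier := {F | ∃ G ∈ S, F =ᵐ[torusMeasure] fun x => φ (pt x) * G x}
  zero_mem' := by
    refine ⟨0, S.zero_mem, ?_⟩
    filter_upwards [Lp.coeFn_zero ℂ 2 torusMeasure] with x hx
    rw [hx, Pi.zero_apply, mul_zero]
  add_mem' := by
    rintro F F' ⟨G, hG, h⟩ ⟨G', hG', h'⟩
    refine ⟨G + G', S.add_mem hG hG', ?_⟩
    filter_upwards [h, h', Lp.coeFn_add F F', Lp.coeFn_add G G'] with x h1 h2 h3 h4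
    rw [h3, h4, Pi.add_apply, Pi.add_apply, h1, h2, mul_add]
  smul_mem' := by
    rintro c F ⟨G, hG, h⟩
    refine ⟨c • G, S.smul_mem c hG, ?_⟩
    filter_upwards [h, Lp.coeFn_smul c F, Lp.coeFn_smul c G] with x h1 h2 h3
    rw [h2, h3, Pi.smul_apply, Pi.smul_apply, h1, smul_eq_mul, smul_eq_mul]
    ring

/-- The closed linear span in `H²(𝔻²)` of the kernel functions `K(·, w)`, `w ∈ 𝔻²`, each given
almost everywhere on `𝕋²` by the formula for `K`.  This is the reproducing kernel Hilbert space
`𝓗(K)` whenever `𝓗(K)` is a closed subspace of `H²(𝔻²)`. -/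
def kernelSpace (K : ℂ × ℂ → ℂ × ℂ → ℂ) : Submodule ℂ L2Torus :=
  (Submodule.span ℂ {F | F ∈ hardy ∧ ∃ w : ℂ × ℂ, ‖w.1‖ < 1 ∧ ‖w.2‖ < 1 ∧
    F =ᵐ[torusMeasure] fun x => K (pt x) w}).topologicalClosure

/-! ### Rational inner functions of degree `(1,1)` -/

/-- The polynomial `p(z) = a + b z₁ + c z₂ + d z₁ z₂`. -/
def poly (a b c d : ℂ) : MvPolynomial (Fin 2) ℂ :=
  MvPolynomial.C a + MvPolynomial.C b * MvPolynomial.X 0 + MvPolynomial.C c * MvPolynomial.X 1 +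
    MvPolynomial.C d * MvPolynomial.X 0 * MvPolynomial.X 1

/-- The reflection `p̃(z) = z₁ z₂ conj (p (1 / conj z₁, 1 / conj z₂))`, which is
`conj d + conj c z₁ + conj b z₂ + conj a z₁ z₂`. -/
def polyRefl (a b c d : ℂ) : MvPolynomial (Fin 2) ℂ :=
  poly (conj d) (conj c) (conj b) (conj a)

/-- The value `p(z)`. -/
def pval (a b c d : ℂ) (z : ℂ × ℂ) : ℂ := MvPolynomial.eval ![z.1, z.2] (poly a b c d)

/-- The value `p̃(z)`. -/
def pReflVal (a b c d : ℂ) (z : ℂ × ℂ) : ℂ := MvPolynomial.eval ![z.1, z.2] (polyRefl a b c d)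

lemma pval_eq (a b c d : ℂ) (z : ℂ × ℂ) :
    pval a b c d z = a + b * z.1 + c * z.2 + d * z.1 * z.2 := by
  simp [pval, poly]

lemma pReflVal_eq (a b c d : ℂ) (z : ℂ × ℂ) :
    pReflVal a b c d z = conj d + conj c * z.1 + conj b * z.2 + conj a * z.1 * z.2 := by
  simp [pReflVal, polyRefl, poly]

/-- The function `θ = p̃ / p`. -/
def theta (a b c d : ℂ) (z : ℂ × ℂ) : ℂ := pReflVal a b c d z / pval a b c d z

/-- `θ = p̃ / p` is a rational inner function of degree `(1,1)` in its canonical form: `p` has no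
zeros on `𝔻²`, and `p` and `p̃` have no common factor.  (Then `|θ| = 1` a.e. on `𝕋²`, and the
degree is exactly `(1,1)` because `a = p(0,0) ≠ 0`, so `z₁ z₂` occurs in `p̃`.) -/
def IsInnerOneOne (a b c d : ℂ) : Prop :=
  (∀ z : ℂ × ℂ, ‖z.1‖ < 1 → ‖z.2‖ < 1 → pval a b c d z ≠ 0) ∧
    IsRelPrime (poly a b c d) (polyRefl a b c d)

/-- `f(z) = λ (z₂ - τ₂) / p(z)` with `|λ|² = |conj a c - d conj b|`; the choice `λ ≥ 0` is made. -/
def fBasis (a b c d τ₂ : ℂ) (z : ℂ × ℂ) : ℂ :=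
  (Real.sqrt ‖conj a * c - d * conj b‖ : ℂ) * (z.2 - τ₂) / pval a b c d z

/-- The canonical `z₂`-invariant subspace `𝓢_{2,θ} = 𝓗(f(z) conj f(w) / (1 - z₂ conj w₂))` of
the model space of `θ`. -/
def S₂θ (a b c d τ₂ : ℂ) : Submodule ℂ L2Torus :=
  kernelSpace fun z w =>
    fBasis a b c d τ₂ z * conj (fBasis a b c d τ₂ w) / (1 - z.2 * conj w.2)

/-- The `z₂`-invariant subspace `𝓢₂ = 𝓢_{2,θ₁} ⊕ θ₁ 𝓢_{2,θ₂}` of the model space of `Θ = θ₁ θ₂`.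
The two summands are closed and orthogonal, so the closure adds nothing to their sum. -/
def S₂ (a b c d τ₂ : Fin 2 → ℂ) : Submodule ℂ L2Torus :=
  (S₂θ (a 0) (b 0) (c 0) (d 0) (τ₂ 0) ⊔
    mulSubspace (theta (a 0) (b 0) (c 0) (d 0))
      (S₂θ (a 1) (b 1) (c 1) (d 1) (τ₂ 1))).topologicalClosure

instance (a b c d τ₂ : Fin 2 → ℂ) : CompleteSpace (S₂ a b c d τ₂) :=
  (Submodule.isClosed_topologicalClosure _).completeSpace_coe

/-- The compression of the shift `S¹_Θ = P_{𝓢₂} M_{z₁}|_{𝓢₂}`. -/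
def compressedShift (a b c d τ₂ : Fin 2 → ℂ) : S₂ a b c d τ₂ →L[ℂ] S₂ a b c d τ₂ :=
  compression Mz₁ (S₂ a b c d τ₂)

/-! ### Foci and circles -/

/-- The focus `f_z = conj (-(b + d z) / (a + c z))`. -/
def focus (a b c d z : ℂ) : ℂ := conj (-((b + d * z) / (a + c * z)))

/-- The circle `{-(b + d z) / (a + c z) : z ∈ 𝕋}`. -/
def focusCircle (a b c d : ℂ) : Set ℂ := {w | ∃ z : ℂ, ‖z‖ = 1 ∧ w = -((b + d * z) / (a + c * z))}

/-- The centre of a circle `C` in the complex plane (an arbitrary number if `C` is not a circle). -/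
def circleCenter (C : Set ℂ) : ℂ :=
  Classical.epsilon fun β : ℂ => ∃ r : ℝ, 0 < r ∧ C = Metric.sphere β r

end BidiskShift

end

noncomputable section

namespace BidiskShift

/-! ### Algebra of the denominator polynomial -/

section Algebra

variable {a b c d : ℂ}

/-! The compression is, in quadratic form, multiplication by a triangular `2 × 2` matrix function of
`z₂`. On `𝕋` the degree one trigonometric polynomial `|a + c z|² - |b + d z|²` is nonnegative and
vanishes at `τ₂`, so it equals `|κ| |z - τ₂|²` with `κ = conj a c - d conj b` (`normSq_sub_eq`).
Hence on a slice `z₂ = z` the function `|f|²` is a Poisson kernel in `z₁`. Integrating `z₁ |v₁ f₁ +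
v₂ θ₁ f₂|²` over `z₁` gives `symbolForm` (`integral_slice_pairFun`): the diagonal entries are the
foci `f_{1,z}`, `f_{2,z}`, and the single off-diagonal entry `δ` satisfies `|δ|² = (1 -
|f_{1,z}|²)(1 - |f_{2,z}|²)` (`norm_offDiag_sq`).

Multiply `v₁ f₁ + v₂ θ₁ f₂` by `1 / (1 - z₂ conj s)` with `s = r γ`. This stays in `𝓢₂`, and `(1 -
r²)` times its quadratic form is a Poisson average of `symbolForm`, which tends to the value at `γ`
as `r → 1`. So any half plane `Re (u w) > 0` containing a value of `symbolForm` also meets the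
numerical range (`exists_inner_compressedShift_re_pos`).

The numerical range is convex, so `0` is interior once every such half plane is met
(`zero_mem_interior_numericalRange`). Under the first condition the matrix at `γ` alone suffices:
its numerical range is an ellipse with foci `f_{j,γ}` and major axis `|1 - conj f_{1,γ} f_{2,γ}|`,
and the condition puts `0` inside (`exists_form_re_pos`). Under the second, `0` lies inside the
circle traced by the foci, which are diagonal entries of the matrices, so every half plane contains
a focus (`exists_focus_re_pos`). The final equivalence compares the explicit radius and centre of
that circle (`focusCircle_eq`). -/

lemma normSq_sub_normSq (a b c d : ℂ) {z : ℂ} (hz : ‖z‖ = 1) :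
    ‖a + c * z‖ ^ 2 - ‖b + d * z‖ ^ 2 =
      ‖a‖ ^ 2 + ‖c‖ ^ 2 - ‖b‖ ^ 2 - ‖d‖ ^ 2 + 2 * ((conj a * c - d * conj b) * z).re := by
  have hz' : z.re * z.re + z.im * z.im = 1 := by
    rw [← Complex.normSq_apply, ← Complex.sq_norm, hz]; norm_num
  simp only [Complex.sq_norm, Complex.normSq_apply, Complex.add_re, Complex.add_im, Complex.mul_re,
    Complex.mul_im, Complex.sub_re, Complex.sub_im, Complex.conj_re, Complex.conj_im]
  linear_combination (c.re ^ 2 + c.im ^ 2 - d.re ^ 2 - d.im ^ 2) * hz'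

lemma normSq_sub_unit {z τ : ℂ} (hz : ‖z‖ = 1) (hτ : ‖τ‖ = 1) :
    ‖z - τ‖ ^ 2 = 2 - 2 * (conj τ * z).re := by
  have hz' : z.re * z.re + z.im * z.im = 1 := by
    rw [← Complex.normSq_apply, ← Complex.sq_norm, hz]; norm_num
  have hτ' : τ.re * τ.re + τ.im * τ.im = 1 := by
    rw [← Complex.normSq_apply, ← Complex.sq_norm, hτ]; norm_num
  simp only [Complex.sq_norm, Complex.normSq_apply, Complex.sub_re, Complex.sub_im, Complex.mul_re,
    Complex.conj_re, Complex.conj_im]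
  linear_combination hz' + hτ'

lemma conj_mul_self_of_norm_one {z : ℂ} (hz : ‖z‖ = 1) : conj z * z = 1 := by
  rw [Complex.conj_mul', hz]; norm_num

/-- If `p` has no zeros on the bidisk, then `|b + d z| ≤ |a + c z|` on the closed disk. -/
lemma norm_le_of_nonvanishing
    (hp : ∀ z : ℂ × ℂ, ‖z.1‖ < 1 → ‖z.2‖ < 1 → pval a b c d z ≠ 0) {z : ℂ} (hz : ‖z‖ ≤ 1) :
    ‖b + d * z‖ ≤ ‖a + c * z‖ := by
  have hin : ∀ z ∈ Metric.ball (0 : ℂ) 1, ‖b + d * z‖ ≤ ‖a + c * z‖ := by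
    intro z hz
    by_contra! h
    have hB : b + d * z ≠ 0 := norm_pos_iff.1 ((norm_nonneg _).trans_lt h)
    refine hp (-(a + c * z) / (b + d * z), z) ?_ (by simpa using hz) ?_
    · rw [norm_div, norm_neg]
      exact (div_lt_one (norm_pos_iff.2 hB)).2 h
    · rw [pval_eq]
      linear_combination div_mul_cancel₀ (-(a + c * z)) hB
  have hcl : z ∈ closure (Metric.ball (0 : ℂ) 1) := by
    rw [closure_ball _ one_ne_zero]; simpa using hz
  exact le_on_closure hin (by fun_prop) (by fun_prop) hcl

lemma a_ne_zero (hp : ∀ z : ℂ × ℂ, ‖z.1‖ < 1 → ‖z.2‖ < 1 → pval a b c d z ≠ 0) : a ≠ 0 := by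
  simpa [pval_eq] using hp (0, 0) (by simp) (by simp)

/-- Otherwise `-a / c` is in the closed disk, and domination makes `b + d z` vanish there together
with `a + c z`, forcing `a d = b c`. -/
lemma norm_c_lt_norm_a (hp : ∀ z : ℂ × ℂ, ‖z.1‖ < 1 → ‖z.2‖ < 1 → pval a b c d z ≠ 0)
    (hdet : a * d ≠ b * c) : ‖c‖ < ‖a‖ := by
  by_contra! h
  have ha := a_ne_zero hp
  have hc : c ≠ 0 := norm_pos_iff.1 ((norm_pos_iff.2 ha).trans_le h)
  have hz : ‖-a / c‖ ≤ 1 := by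
    rw [norm_div, norm_neg]; exact (div_le_one (norm_pos_iff.2 hc)).2 h
  have h1 := norm_le_of_nonvanishing hp hz
  have h2 : a + c * (-a / c) = 0 := by field_simp; ring
  rw [h2, norm_zero] at h1
  have h3 : b + d * (-a / c) = 0 := by simpa using h1
  apply hdet
  field_simp at h3
  linear_combination -h3

lemma affine_ne_zero (h : ‖c‖ < ‖a‖) {z : ℂ} (hz : ‖z‖ ≤ 1) : a + c * z ≠ 0 := by
  intro h0
  have : ‖a‖ = ‖c‖ * ‖z‖ := by
    rw [← norm_mul, ← norm_neg (c * z)]; congr 1; linear_combination h0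
  nlinarith [norm_nonneg c]

lemma not_isUnit_of_eval_eq_zero {q : MvPolynomial (Fin 2) ℂ} (x : Fin 2 → ℂ)
    (h : MvPolynomial.eval x q = 0) : ¬ IsUnit q := fun hu => by
  have := hu.map (MvPolynomial.eval x)
  rw [h] at this
  exact not_isUnit_zero this

lemma conj_affine_eq_zero {u v τ : ℂ} (hτ : ‖τ‖ = 1) (h : u + v * τ = 0) :
    conj v + conj u * τ = 0 := by
  have h1 := conj_mul_self_of_norm_one hτ
  have h2 : conj u + conj v * conj τ = 0 := by simpa using congrArg conj h
  linear_combination τ * h2 - conj v * h1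

/-- If `a d = b c`, then `a p = (a + b z₁)(a + c z₂)`, and one factor vanishes at the boundary zero.
An affine polynomial and its reflection have the same zeros on the circle, so `z₁ - τ₁` or `z₂ - τ₂`
divides both `p` and `p̃`. -/
lemma det_ne_zero {τ₁ τ₂ : ℂ} (h : IsInnerOneOne a b c d) (hτ₁ : ‖τ₁‖ = 1) (hτ₂ : ‖τ₂‖ = 1)
    (hzero : pval a b c d (τ₁, τ₂) = 0) : a * d ≠ b * c := by
  intro hdet
  have ha := a_ne_zero h.1
  have hca : conj a ≠ 0 := by simpa using ha
  have hdet' : conj a * conj d = conj b * conj c := by simpa using congrArg conj hdet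
  have hd : d = b * c / a := by field_simp; linear_combination hdet
  have hfac : (a + b * τ₁) * (a + c * τ₂) = 0 := by
    rw [pval_eq] at hzero
    linear_combination a * hzero - τ₁ * τ₂ * hdet
  rcases mul_eq_zero.1 hfac with h0 | h0
  · have h1 := conj_affine_eq_zero hτ₁ h0
    have hb : b = -a * conj τ₁ := by
      linear_combination (conj τ₁) * h0 - b * conj_mul_self_of_norm_one hτ₁
    have hcb : conj b = -conj a * τ₁ := by linear_combination h1
    have hd1 : d = - c * conj τ₁ := by rw [hd, hb]; field_simp
    have hcd : conj d = -conj c * τ₁ := by rw [hd1]; simp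
    refine not_isUnit_of_eval_eq_zero (q := MvPolynomial.X 0 - MvPolynomial.C τ₁) ![τ₁, 0]
      (by simp) (h.2 (d := MvPolynomial.X 0 - MvPolynomial.C τ₁) ?_ ?_)
    · refine ⟨MvPolynomial.C b + MvPolynomial.C d * MvPolynomial.X 1, ?_⟩
      have e1 : a = -(τ₁ * b) := by linear_combination h0
      have e2 : c = -(τ₁ * d) := by
        rw [hd1]; linear_combination -c * conj_mul_self_of_norm_one hτ₁
      have E1 : (MvPolynomial.C a : MvPolynomial (Fin 2) ℂ) =
          -(MvPolynomial.C τ₁ * MvPolynomial.C b) := by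
        rw [← MvPolynomial.C_mul, ← MvPolynomial.C_neg, ← e1]
      have E2 : (MvPolynomial.C c : MvPolynomial (Fin 2) ℂ) =
          -(MvPolynomial.C τ₁ * MvPolynomial.C d) := by
        rw [← MvPolynomial.C_mul, ← MvPolynomial.C_neg, ← e2]
      rw [poly]
      linear_combination E1 + MvPolynomial.X 1 * E2
    · refine ⟨MvPolynomial.C (conj c) + MvPolynomial.C (conj a) * MvPolynomial.X 1, ?_⟩
      rw [polyRefl, poly, hcb, hcd]
      simp only [MvPolynomial.C_mul, MvPolynomial.C_neg]
      ring
  · have h1 := conj_affine_eq_zero hτ₂ h0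
    have hb : c = -a * conj τ₂ := by
      linear_combination (conj τ₂) * h0 - c * conj_mul_self_of_norm_one hτ₂
    have hcb : conj c = -conj a * τ₂ := by linear_combination h1
    have hd1 : d = - b * conj τ₂ := by rw [hd, hb]; field_simp
    have hcd : conj d = -conj b * τ₂ := by rw [hd1]; simp
    refine not_isUnit_of_eval_eq_zero (q := MvPolynomial.X 1 - MvPolynomial.C τ₂) ![0, τ₂]
      (by simp) (h.2 (d := MvPolynomial.X 1 - MvPolynomial.C τ₂) ?_ ?_)
    · refine ⟨MvPolynomial.C c + MvPolynomial.C d * MvPolynomial.X 0, ?_⟩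
      have e1 : a = -(τ₂ * c) := by linear_combination h0
      have e2 : b = -(τ₂ * d) := by
        rw [hd1]; linear_combination -b * conj_mul_self_of_norm_one hτ₂
      have E1 : (MvPolynomial.C a : MvPolynomial (Fin 2) ℂ) =
          -(MvPolynomial.C τ₂ * MvPolynomial.C c) := by
        rw [← MvPolynomial.C_mul, ← MvPolynomial.C_neg, ← e1]
      have E2 : (MvPolynomial.C b : MvPolynomial (Fin 2) ℂ) =
          -(MvPolynomial.C τ₂ * MvPolynomial.C d) := by
        rw [← MvPolynomial.C_mul, ← MvPolynomial.C_neg, ← e2]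
      rw [poly]
      linear_combination E1 + MvPolynomial.X 0 * E2
    · refine ⟨MvPolynomial.C (conj b) + MvPolynomial.C (conj a) * MvPolynomial.X 0, ?_⟩
      rw [polyRefl, poly, hcb, hcd]
      simp only [MvPolynomial.C_mul, MvPolynomial.C_neg]
      ring

/-- If the reflection is a multiple of the polynomial, there is a common factor. -/
lemma not_proportional {τ₁ τ₂ : ℂ} (h : IsInnerOneOne a b c d)
    (hzero : pval a b c d (τ₁, τ₂) = 0) (ζ : ℂ) :
    ¬ (conj d = ζ * a ∧ conj c = ζ * b ∧ conj b = ζ * c ∧ conj a = ζ * d) := by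
  rintro ⟨h1, h2, h3, h4⟩
  refine not_isUnit_of_eval_eq_zero (q := poly a b c d) ![τ₁, τ₂] hzero (h.2 dvd_rfl ?_)
  refine ⟨MvPolynomial.C ζ, ?_⟩
  rw [polyRefl, h1, h2, h3, h4]
  simp only [poly, MvPolynomial.C_mul]
  ring

lemma normSq_zero_eq {τ₁ τ₂ : ℂ} (hτ₁ : ‖τ₁‖ = 1) (hzero : pval a b c d (τ₁, τ₂) = 0) :
    ‖a + c * τ₂‖ ^ 2 - ‖b + d * τ₂‖ ^ 2 = 0 := by
  rw [pval_eq] at hzero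
  have : a + c * τ₂ = -((b + d * τ₂) * τ₁) := by linear_combination hzero
  rw [this, norm_neg, norm_mul, hτ₁, mul_one, sub_self]

/-- The two coefficients of the trigonometric polynomial `|a + c z|² - |b + d z|²`. -/
lemma coeff_relations {τ₁ τ₂ : ℂ}
    (hp : ∀ z : ℂ × ℂ, ‖z.1‖ < 1 → ‖z.2‖ < 1 → pval a b c d z ≠ 0)
    (hτ₁ : ‖τ₁‖ = 1) (hτ₂ : ‖τ₂‖ = 1) (hzero : pval a b c d (τ₁, τ₂) = 0) :
    ‖a‖ ^ 2 + ‖c‖ ^ 2 - ‖b‖ ^ 2 - ‖d‖ ^ 2 = 2 * ‖conj a * c - d * conj b‖ ∧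
      (conj a * c - d * conj b) * τ₂ = -‖conj a * c - d * conj b‖ := by
  set κ := conj a * c - d * conj b with hκ
  have h0 := normSq_zero_eq hτ₁ hzero
  rw [normSq_sub_normSq a b c d hτ₂, ← hκ] at h0
  have hle : 2 * ‖κ‖ ≤ ‖a‖ ^ 2 + ‖c‖ ^ 2 - ‖b‖ ^ 2 - ‖d‖ ^ 2 := by
    rcases eq_or_ne κ 0 with h | h
    · rw [h] at h0 ⊢
      simp only [zero_mul, Complex.zero_re, norm_zero] at h0 ⊢
      linarith
    · have hn : ‖κ‖ ≠ 0 := norm_ne_zero_iff.2 h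
      -- At this point `Re (κ z)` takes its minimum `-‖κ‖`; nonnegativity there gives the bound, and
      -- the zero at `τ₂` makes it an equality.
      have hz : ‖-conj κ / ‖κ‖‖ = 1 := by
        rw [norm_div, norm_neg, RCLike.norm_conj, Complex.norm_real, norm_norm, div_self hn]
      have h1 := normSq_sub_normSq a b c d hz
      have h2 := norm_le_of_nonvanishing hp hz.le
      have h3 : κ * (-conj κ / ‖κ‖) = ((-‖κ‖ : ℝ) : ℂ) := by
        have : (‖κ‖ : ℂ) ≠ 0 := by exact_mod_cast hn
        field_simp
        rw [Complex.mul_conj']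
        push_cast
        ring
      rw [← hκ, h3, Complex.ofReal_re] at h1
      have h4 := pow_le_pow_left₀ (norm_nonneg _) h2 2
      linarith
  have hre : |(κ * τ₂).re| ≤ ‖κ‖ := by
    have := Complex.abs_re_le_norm (κ * τ₂)
    rwa [norm_mul, hτ₂, mul_one] at this
  have hre' := (abs_le.1 hre).1
  have hre2 : (κ * τ₂).re = -‖κ‖ := by linarith
  refine ⟨by linarith, ?_⟩
  have hsq := Complex.sq_norm (κ * τ₂)
  rw [Complex.normSq_apply, norm_mul, hτ₂, mul_one, hre2] at hsq
  have him : (κ * τ₂).im = 0 := by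
    have : (κ * τ₂).im * (κ * τ₂).im = 0 := by linarith
    simpa using this
  apply Complex.ext
  · simpa using hre2
  · simpa using him

lemma normSq_sub_eq {τ₁ τ₂ : ℂ}
    (hp : ∀ z : ℂ × ℂ, ‖z.1‖ < 1 → ‖z.2‖ < 1 → pval a b c d z ≠ 0)
    (hτ₁ : ‖τ₁‖ = 1) (hτ₂ : ‖τ₂‖ = 1) (hzero : pval a b c d (τ₁, τ₂) = 0)
    {z : ℂ} (hz : ‖z‖ = 1) :
    ‖a + c * z‖ ^ 2 - ‖b + d * z‖ ^ 2 = ‖conj a * c - d * conj b‖ * ‖z - τ₂‖ ^ 2 := by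
  obtain ⟨h1, h2⟩ := coeff_relations hp hτ₁ hτ₂ hzero
  rw [normSq_sub_normSq a b c d hz, normSq_sub_unit hz hτ₂, h1]
  have h3 : (conj a * c - d * conj b) * z = -(‖conj a * c - d * conj b‖ * (conj τ₂ * z)) := by
    linear_combination (conj τ₂ * z) * h2
      - (conj a * c - d * conj b) * z * conj_mul_self_of_norm_one hτ₂
  rw [h3, Complex.neg_re, Complex.re_ofReal_mul]
  ring

/-- If `κ = 0`, then `|a|², |c|²` and `|b|², |d|²` have equal sums and equal products. Either `|a| =
|b|`, which leads to `a d = b c`, or `|a| = |d|`, which makes `p̃` a multiple of `p`. -/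
lemma kappa_ne_zero {τ₁ τ₂ : ℂ} (h : IsInnerOneOne a b c d) (hτ₁ : ‖τ₁‖ = 1) (hτ₂ : ‖τ₂‖ = 1)
    (hzero : pval a b c d (τ₁, τ₂) = 0) : conj a * c - d * conj b ≠ 0 := by
  intro hκ
  have hdet := det_ne_zero h hτ₁ hτ₂ hzero
  have ha := a_ne_zero h.1
  obtain ⟨h1, -⟩ := coeff_relations h.1 hτ₁ hτ₂ hzero
  rw [hκ, norm_zero, mul_zero] at h1
  have e : conj a * c = d * conj b := by linear_combination hκ
  have e' : a * conj c = conj d * b := by simpa using congrArg conj e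
  have h2 : ‖a‖ * ‖c‖ = ‖d‖ * ‖b‖ := by simpa using congrArg norm e
  have h3 : (‖a‖ ^ 2 - ‖b‖ ^ 2) * (‖a‖ ^ 2 - ‖d‖ ^ 2) = 0 := by
    linear_combination ‖a‖ ^ 2 * h1 - (‖a‖ * ‖c‖ + ‖d‖ * ‖b‖) * h2
  rcases mul_eq_zero.1 h3 with h4 | h4
  · have h5 : conj a * a = conj b * b := by
      rw [Complex.conj_mul', Complex.conj_mul']; exact_mod_cast sub_eq_zero.1 h4
    have hb : conj b ≠ 0 := by
      intro hb
      rw [hb, zero_mul] at h5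
      simp [ha] at h5
    apply hdet
    apply mul_left_cancel₀ hb
    linear_combination -a * e + c * h5
  · have h5 : conj a * a = conj d * d := by
      rw [Complex.conj_mul', Complex.conj_mul']; exact_mod_cast sub_eq_zero.1 h4
    refine not_proportional h hzero (conj d / a) ⟨by field_simp, ?_, ?_, ?_⟩
    · field_simp; linear_combination e'
    · have hd : d ≠ 0 := by
        intro hd
        rw [hd, mul_zero] at h5
        simp [ha] at h5
      have : d * conj b * a = d * (conj d * c) := by linear_combination -a * e + c * h5
      field_simp
      apply mul_left_cancel₀ hd
      linear_combination this
    · field_simp; linear_combination h5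

/-! ### The circle of foci -/

/-- After subtracting the centre, the Möbius map becomes a constant times the Blaschke factor `(conj
c + conj a z) / (a + c z)`, which maps the circle onto itself. -/
lemma focusCircle_eq (hca : ‖c‖ < ‖a‖) (hdet : a * d ≠ b * c) :
    focusCircle a b c d =
      Metric.sphere (-((conj a * b - conj c * d) / ((‖a‖ ^ 2 - ‖c‖ ^ 2 : ℝ) : ℂ)))
        (‖a * d - b * c‖ / (‖a‖ ^ 2 - ‖c‖ ^ 2)) := by
  have hD : 0 < ‖a‖ ^ 2 - ‖c‖ ^ 2 := by nlinarith [norm_nonneg c]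
  set D : ℝ := ‖a‖ ^ 2 - ‖c‖ ^ 2 with hDdef
  have hDC : (D : ℂ) ≠ 0 := by exact_mod_cast hD.ne'
  have hDe : (D : ℂ) = conj a * a - conj c * c := by
    rw [Complex.conj_mul', Complex.conj_mul', hDdef]; push_cast; ring
  have hdet' : a * d - b * c ≠ 0 := sub_ne_zero.2 hdet
  have key : ∀ z, a + c * z ≠ 0 → -((b + d * z) / (a + c * z)) -
      -((conj a * b - conj c * d) / (D : ℂ)) =
        -((a * d - b * c) / D * ((conj c + conj a * z) / (a + c * z))) := by
    intro z hz
    simp only [div_eq_mul_inv]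
    linear_combination (b + d * z) * (a + c * z)⁻¹ * mul_inv_cancel₀ hDC
      - (conj a * b - conj c * d) * (D : ℂ)⁻¹ * mul_inv_cancel₀ hz
      - (b + d * z) * (a + c * z)⁻¹ * (D : ℂ)⁻¹ * hDe
  have hnorm : ∀ z : ℂ, ‖z‖ = 1 → ‖conj c + conj a * z‖ = ‖a + c * z‖ := by
    intro z hz
    have : conj c + conj a * z = z * conj (a + c * z) := by
      simp only [map_add, map_mul]
      linear_combination -conj c * conj_mul_self_of_norm_one hz
    rw [this, norm_mul, hz, one_mul, RCLike.norm_conj]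
  ext w
  simp only [focusCircle, Set.mem_ofPred_eq, mem_sphere_iff_norm]
  constructor
  · rintro ⟨z, hz, rfl⟩
    have hA := affine_ne_zero hca hz.le
    rw [key z hA, norm_neg, norm_mul, norm_div, norm_div, hnorm z hz,
      div_self (norm_ne_zero_iff.2 hA), mul_one, Complex.norm_real, Real.norm_of_nonneg hD.le]
  · intro hw
    set ζ : ℂ := -((w - -((conj a * b - conj c * d) / (D : ℂ))) * D / (a * d - b * c)) with hζ
    have hζn : ‖ζ‖ = 1 := by
      rw [hζ, norm_neg, norm_div, norm_mul, hw, Complex.norm_real, Real.norm_of_nonneg hD.le]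
      have : ‖a * d - b * c‖ ≠ 0 := norm_ne_zero_iff.2 hdet'
      field_simp
    have hden : conj a - c * ζ ≠ 0 := by
      have := affine_ne_zero (a := conj a) (c := -c) (by simpa using hca) hζn.le
      rwa [neg_mul, ← sub_eq_add_neg] at this
    -- The preimage of `ζ` under the Blaschke factor.
    have hz : ‖(a * ζ - conj c) / (conj a - c * ζ)‖ = 1 := by
      have : a * ζ - conj c = ζ * conj (conj a - c * ζ) := by
        simp only [map_sub, map_mul, Complex.conj_conj]
        linear_combination conj c * conj_mul_self_of_norm_one hζn
      rw [this, norm_div, norm_mul, hζn, one_mul, RCLike.norm_conj,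
        div_self (norm_ne_zero_iff.2 hden)]
    have hA := affine_ne_zero hca hz.le
    refine ⟨_, hz, ?_⟩
    have h1 := key _ hA
    have h2 : (conj c + conj a * ((a * ζ - conj c) / (conj a - c * ζ))) /
        (a + c * ((a * ζ - conj c) / (conj a - c * ζ))) = ζ := by
      rw [div_eq_iff hA]
      linear_combination div_mul_cancel₀ (a * ζ - conj c) hden
    rw [h2, hζ] at h1
    have h3 : -((a * d - b * c) / (D : ℂ) *
        -((w - -((conj a * b - conj c * d) / (D : ℂ))) * D / (a * d - b * c))) =
        w - -((conj a * b - conj c * d) / (D : ℂ)) := by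
      field_simp
    rw [h3] at h1
    exact (sub_left_injective h1).symm

/-- The antipodal pairs `x ± r` and `x ± i r` are each equidistant from `y`. This pins down the
value chosen by `circleCenter`. -/
lemma sphere_center_unique {x y : ℂ} {r s : ℝ} (hr : 0 < r)
    (h : Metric.sphere x r = Metric.sphere y s) : x = y := by
  have mem : ∀ u : ℂ, ‖u‖ = 1 → ‖x + r * u - y‖ = s := fun u hu => by
    rw [← mem_sphere_iff_norm, ← h, mem_sphere_iff_norm, add_sub_cancel_left, norm_mul, hu,
      mul_one, Complex.norm_real, Real.norm_of_nonneg hr.le]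
  have e1 := mem 1 (by simp)
  have e2 := mem (-1) (by simp)
  have e3 := mem Complex.I (by simp)
  have e4 := mem (-Complex.I) (by simp)
  have q1 := congrArg (· ^ 2) (e1.trans e2.symm)
  have q2 := congrArg (· ^ 2) (e3.trans e4.symm)
  simp only [Complex.sq_norm, Complex.normSq_apply] at q1 q2
  simp at q1 q2
  apply Complex.ext
  · nlinarith
  · nlinarith

lemma circleCenter_focusCircle (hca : ‖c‖ < ‖a‖) (hdet : a * d ≠ b * c) :
    circleCenter (focusCircle a b c d) =
      -((conj a * b - conj c * d) / ((‖a‖ ^ 2 - ‖c‖ ^ 2 : ℝ) : ℂ)) := by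
  have hD : 0 < ‖a‖ ^ 2 - ‖c‖ ^ 2 := by nlinarith [norm_nonneg c]
  have hR : 0 < ‖a * d - b * c‖ / (‖a‖ ^ 2 - ‖c‖ ^ 2) :=
    div_pos (norm_pos_iff.2 (sub_ne_zero.2 hdet)) hD
  have hex : ∃ β : ℂ, ∃ r : ℝ, 0 < r ∧ focusCircle a b c d = Metric.sphere β r :=
    ⟨_, _, hR, focusCircle_eq hca hdet⟩
  obtain ⟨r, hr, h⟩ := Classical.epsilon_spec hex
  exact sphere_center_unique hr (h.symm.trans (focusCircle_eq hca hdet))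

/-- The distance from a focus to the centre is the radius. -/
lemma norm_center_sub_focus (hca : ‖c‖ < ‖a‖) (hdet : a * d ≠ b * c) {z : ℂ} (hz : ‖z‖ = 1) :
    ‖conj (circleCenter (focusCircle a b c d)) - focus a b c d z‖ =
      ‖a * d - b * c‖ / (‖a‖ ^ 2 - ‖c‖ ^ 2) := by
  have h : -((b + d * z) / (a + c * z)) ∈ focusCircle a b c d := ⟨z, hz, rfl⟩
  rw [focusCircle_eq hca hdet, mem_sphere_iff_norm, ← circleCenter_focusCircle hca hdet] at h
  rw [focus, ← map_sub, RCLike.norm_conj, norm_sub_rev, h]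

lemma center_condition_iff (hca : ‖c‖ < ‖a‖) (hdet : a * d ≠ b * c) {z : ℂ} (hz : ‖z‖ = 1) :
    ‖conj (circleCenter (focusCircle a b c d)) - focus a b c d z‖ >
        ‖conj (circleCenter (focusCircle a b c d))‖ ↔
      ‖a * d - b * c‖ > ‖a * conj b - c * conj d‖ := by
  have hD : 0 < ‖a‖ ^ 2 - ‖c‖ ^ 2 := by nlinarith [norm_nonneg c]
  have h : ‖conj a * b - conj c * d‖ = ‖a * conj b - c * conj d‖ := by
    rw [← RCLike.norm_conj]; simp
  rw [norm_center_sub_focus hca hdet hz, RCLike.norm_conj, circleCenter_focusCircle hca hdet,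
    norm_neg, norm_div, Complex.norm_real, Real.norm_of_nonneg hD.le, h, gt_iff_lt,
    div_lt_div_iff_of_pos_right hD]

/-- When `0` is inside the circle of foci, some focus lies in any prescribed half plane. -/
lemma exists_focus_re_pos (hca : ‖c‖ < ‖a‖) (hdet : a * d ≠ b * c) {γ : ℂ} (hγ : ‖γ‖ = 1)
    (h : ‖conj (circleCenter (focusCircle a b c d)) - focus a b c d γ‖ >
        ‖conj (circleCenter (focusCircle a b c d))‖) {u : ℂ} (hu : ‖u‖ = 1) :
    ∃ z : ℂ, ‖z‖ = 1 ∧ 0 < (u * focus a b c d z).re := by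
  rw [norm_center_sub_focus hca hdet hγ, RCLike.norm_conj] at h
  set R := ‖a * d - b * c‖ / (‖a‖ ^ 2 - ‖c‖ ^ 2)
  set β := circleCenter (focusCircle a b c d) with hβ
  have hR : 0 < R := (norm_nonneg _).trans_lt h
  -- The corresponding focus is `conj β + R conj u`, and multiplied by `u` it has real part at least
  -- `R - ‖β‖ > 0`.
  have hmem : β + R * u ∈ focusCircle a b c d := by
    rw [focusCircle_eq hca hdet, ← circleCenter_focusCircle hca hdet, mem_sphere_iff_norm, ← hβ,
      add_sub_cancel_left, norm_mul, hu, mul_one, Complex.norm_real, Real.norm_of_nonneg hR.le]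
  obtain ⟨z, hz, e⟩ := hmem
  refine ⟨z, hz, ?_⟩
  have hval : u * focus a b c d z = u * conj β + R := by
    rw [focus, ← e, map_add, map_mul, Complex.conj_ofReal]
    linear_combination (R : ℂ) * conj_mul_self_of_norm_one hu
  rw [hval, Complex.add_re, Complex.ofReal_re]
  have h1 := Complex.abs_re_le_norm (u * conj β)
  rw [norm_mul, hu, one_mul, RCLike.norm_conj] at h1
  linarith [(abs_le.1 h1).1]

/-! ### Elliptical numerical ranges of `2 × 2` matrices -/

/-- A lower triangular `2 × 2` matrix with `|δ|² = (1-|w₁|²)(1-|w₂|²)` whose elliptical numerical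
range contains `0` in its interior: every half plane contains a value of the form. -/
lemma exists_form_re_pos {w₁ w₂ δ u : ℂ} (hu : ‖u‖ = 1)
    (hδ : ‖δ‖ ^ 2 = (1 - ‖w₁‖ ^ 2) * (1 - ‖w₂‖ ^ 2))
    (h : ‖w₁‖ + ‖w₂‖ < ‖1 - conj w₁ * w₂‖) :
    ∃ v₁ v₂ : ℂ, 0 < (u * (w₁ * (v₁ * conj v₁) + w₂ * (v₂ * conj v₂) + δ * (v₁ * conj v₂))).re := by
  set x := (u * w₁).re with hx
  set y := (u * w₂).re with hy
  have hid : ‖1 - conj w₁ * w₂‖ ^ 2 - ‖δ‖ ^ 2 = ‖w₁‖ ^ 2 + ‖w₂‖ ^ 2 - 2 * (conj w₁ * w₂).re := by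
    rw [hδ]
    simp only [Complex.sq_norm, Complex.normSq_apply, Complex.sub_re, Complex.sub_im,
      Complex.mul_re, Complex.mul_im, Complex.conj_re, Complex.conj_im, Complex.one_re,
      Complex.one_im]
    ring
  -- From `2 x y = Re (u w₁ · u w₂) + Re (conj (u w₁) · u w₂)`, where the rotation cancels in the
  -- second term.
  have hxy : 4 * (x * y) ≤ 2 * (‖w₁‖ * ‖w₂‖) + 2 * (conj w₁ * w₂).re := by
    have e1 : (u * w₁ * (u * w₂)).re ≤ ‖w₁‖ * ‖w₂‖ := by
      refine (Complex.re_le_norm _).trans ?_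
      simp [hu]
    have e2 : (conj (u * w₁) * (u * w₂)).re = (conj w₁ * w₂).re := by
      congr 1
      rw [map_mul]
      linear_combination (conj w₁ * w₂) * conj_mul_self_of_norm_one hu
    simp only [Complex.mul_re (u * w₁), Complex.mul_re (conj (u * w₁)), Complex.conj_re,
      Complex.conj_im, ← hx, ← hy] at e1 e2
    linarith
  have hlt : 4 * (x * y) < ‖δ‖ ^ 2 := by
    have : (‖w₁‖ + ‖w₂‖) ^ 2 < ‖1 - conj w₁ * w₂‖ ^ 2 :=
      pow_lt_pow_left₀ h (by positivity) two_ne_zero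
    nlinarith
  -- Adjusting the phase of `v₁` makes the cross term real, leaving a real binary form whose
  -- discriminant `‖δ‖² - 4 x y` is positive.
  suffices hs : ∃ s t : ℝ, 0 < x * s ^ 2 + y * t ^ 2 + ‖δ‖ * (s * t) by
    obtain ⟨s, t, hst⟩ := hs
    obtain ⟨ξ, hξ, hξδ⟩ : ∃ ξ : ℂ, ‖ξ‖ = 1 ∧ u * δ * ξ = ‖δ‖ := by
      rcases eq_or_ne δ 0 with h0 | h0
      · exact ⟨1, by simp, by simp [h0]⟩
      · have hn : (‖δ‖ : ℂ) ≠ 0 := by simpa using h0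
        refine ⟨conj (u * δ) / ‖δ‖, ?_, ?_⟩
        · rw [norm_div, RCLike.norm_conj, norm_mul, hu, one_mul, Complex.norm_real, norm_norm,
            div_self (norm_ne_zero_iff.2 h0)]
        · rw [← mul_div_assoc, Complex.mul_conj', norm_mul, hu, one_mul]
          field_simp
    refine ⟨s * ξ, t, ?_⟩
    have : u * (w₁ * (s * ξ * conj (s * ξ)) + w₂ * (t * conj (t : ℂ)) + δ * (s * ξ * conj (t : ℂ)))
        = ((s ^ 2 : ℝ) : ℂ) * (u * w₁) + ((t ^ 2 : ℝ) : ℂ) * (u * w₂) +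
          ((‖δ‖ * (s * t) : ℝ) : ℂ) := by
      simp only [map_mul, Complex.conj_ofReal]
      push_cast
      linear_combination (s : ℂ) * t * hξδ + u * w₁ * s ^ 2 * conj_mul_self_of_norm_one hξ
    rw [this, Complex.add_re, Complex.add_re, Complex.re_ofReal_mul, Complex.re_ofReal_mul,
      Complex.ofReal_re, ← hx, ← hy]
    linarith
  have hδ0 := norm_nonneg δ
  rcases lt_or_ge 0 x with hx0 | hx0
  · exact ⟨1, 0, by simpa using hx0⟩
  rcases lt_or_ge 0 y with hy0 | hy0
  · exact ⟨0, 1, by simpa using hy0⟩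
  rcases hx0.lt_or_eq with hx1 | hx1
  -- The value here is `-x (‖δ‖² - 4 x y)`; in the degenerate case `x = 0` below it is `‖δ‖²`.
  · exact ⟨‖δ‖, -(2 * x), by nlinarith⟩
  · rw [hx1] at hlt ⊢
    exact ⟨1 - y, ‖δ‖, by nlinarith⟩

end Algebra

/-! ### Convexity of the numerical range -/

section Convexity

variable {H : Type*} [NormedAddCommGroup H] [InnerProductSpace ℂ H]

lemma mem_numericalRange_of_ne_zero (T : H →L[ℂ] H) {h : H} (hh : h ≠ 0) :
    inner ℂ h (T h) / ((‖h‖ ^ 2 : ℝ) : ℂ) ∈ numericalRange T := by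
  have hn : ‖h‖ ≠ 0 := norm_ne_zero_iff.2 hh
  refine ⟨((‖h‖⁻¹ : ℝ) : ℂ) • h, ?_, ?_⟩
  · rw [norm_smul, Complex.norm_real, norm_inv, norm_norm, inv_mul_cancel₀ hn]
  · rw [map_smul, inner_smul_left, inner_smul_right, Complex.conj_ofReal]
    push_cast
    field_simp

/-- The **Toeplitz-Hausdorff theorem**. -/
theorem convex_numericalRange (T : H →L[ℂ] H) : Convex ℝ (numericalRange T) := by
  rw [convex_iff_segment_subset]
  rintro p ⟨x, hx, hxp⟩ q ⟨y, hy, hyq⟩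
  rcases eq_or_ne p q with rfl | hpq
  · rw [segment_same]
    rintro _ rfl
    exact ⟨x, hx, hxp⟩
  have hqp : q - p ≠ 0 := sub_ne_zero.2 hpq.symm
  -- the normalised form with values `0` at `x` and `1` at `y`
  set B : H → H → ℂ := fun g h => (inner ℂ g (T h) - p * inner ℂ g h) / (q - p) with hB
  have hBxx : B x x = 0 := by
    simp [hB, hxp, inner_self_eq_norm_sq_to_K, hx]
  have hByy : B y y = 1 := by
    simp [hB, hyq, inner_self_eq_norm_sq_to_K, hy, div_self hqp]
  -- Rotating `x` by `ζ` makes the cross terms real, so `B` is real along the path `v` from `ζ x` to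
  -- `y`. The normalised values `φ` then run continuously from `0` to `1`, and the intermediate
  -- value theorem covers the segment.
  obtain ⟨ζ, hζ, hreal⟩ : ∃ ζ : ℂ, ‖ζ‖ = 1 ∧ (ζ * B y x + conj ζ * B x y).im = 0 := by
    set m := B y x - conj (B x y) with hm
    have him : ∀ ζ : ℂ, (ζ * B y x + conj ζ * B x y).im = (ζ * m).im := by
      intro ζ
      simp only [hm, Complex.add_im, Complex.mul_im, Complex.sub_re, Complex.sub_im,
        Complex.conj_re, Complex.conj_im]
      ring
    rcases eq_or_ne m 0 with h0 | h0
    · exact ⟨1, by simp, by rw [him, h0]; simp⟩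
    · have hn : ‖m‖ ≠ 0 := norm_ne_zero_iff.2 h0
      refine ⟨conj m / ‖m‖, ?_, ?_⟩
      · rw [norm_div, RCLike.norm_conj, Complex.norm_real, norm_norm, div_self hn]
      · rw [him]
        have : conj m / (‖m‖ : ℂ) * m = ((‖m‖ : ℝ) : ℂ) := by
          have : (‖m‖ : ℂ) ≠ 0 := by exact_mod_cast hn
          field_simp
          rw [mul_comm, Complex.mul_conj']
        rw [this, Complex.ofReal_im]
  set ρ : ℝ := (ζ * B y x + conj ζ * B x y).re with hρ
  have hρC : ζ * B y x + conj ζ * B x y = (ρ : ℂ) := by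
    apply Complex.ext <;> simp [hρ, hreal]
  set v : ℝ → H := fun t => (((1 - t : ℝ) : ℂ) * ζ) • x + (t : ℂ) • y with hv
  have hBv : ∀ t, B (v t) (v t) = ((t ^ 2 + t * (1 - t) * ρ : ℝ) : ℂ) := by
    intro t
    have expand : B (v t) (v t) = (1 - t) ^ 2 * (conj ζ * ζ) * B x x + t ^ 2 * B y y +
        t * (1 - t) * (ζ * B y x + conj ζ * B x y) := by
      simp only [hB, hv, map_add, map_smul, inner_add_left, inner_add_right, inner_smul_left,
        inner_smul_right, map_mul, Complex.conj_ofReal]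
      push_cast
      field_simp
      ring
    rw [expand, hBxx, hByy, hρC]
    push_cast
    ring
  -- If `t y` is a multiple of `x`, then `B` at `t y` is both `t²` and `0`; so `t = 0`, and `ζ x`
  -- would vanish.
  have hvne : ∀ t, v t ≠ 0 := by
    intro t ht
    have h1 : (t : ℂ) • y = -((((1 - t : ℝ) : ℂ) * ζ) • x) :=
      eq_neg_of_add_eq_zero_right ht
    have h2 : B ((t : ℂ) • y) ((t : ℂ) • y) = 0 := by
      have : B (-((((1 - t : ℝ) : ℂ) * ζ) • x)) (-((((1 - t : ℝ) : ℂ) * ζ) • x)) =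
          conj (((1 - t : ℝ) : ℂ) * ζ) * (((1 - t : ℝ) : ℂ) * ζ) * B x x := by
        simp only [hB, map_neg, map_smul, inner_neg_left, inner_neg_right, inner_smul_left,
          inner_smul_right]
        ring
      rw [h1, this, hBxx, mul_zero]
    have h3 : B ((t : ℂ) • y) ((t : ℂ) • y) = t * t * B y y := by
      simp only [hB, map_smul, inner_smul_left, inner_smul_right, Complex.conj_ofReal]
      ring
    rw [h3, hByy, mul_one] at h2
    have ht0 : t = 0 := by simpa using h2
    rw [ht0] at ht
    have hζ0 : ζ ≠ 0 := norm_ne_zero_iff.1 (by rw [hζ]; exact one_ne_zero)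
    have hx0 : x ≠ 0 := norm_ne_zero_iff.1 (by rw [hx]; exact one_ne_zero)
    simp [hv, hζ0, hx0] at ht
  set φ : ℝ → ℝ := fun t => (t ^ 2 + t * (1 - t) * ρ) / ‖v t‖ ^ 2 with hφ
  have hvc : Continuous v := by rw [hv]; fun_prop
  have hφc : Continuous φ := by
    refine Continuous.div (by fun_prop) (by fun_prop) fun t => ?_
    exact pow_ne_zero _ (norm_ne_zero_iff.2 (hvne t))
  have hφ0 : φ 0 = 0 := by simp [hφ]
  have hφ1 : φ 1 = 1 := by simp [hφ, hv, hy]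
  intro w hw
  rw [segment_eq_image'] at hw
  obtain ⟨s, hs, rfl⟩ := hw
  obtain ⟨t, -, hts⟩ := intermediate_value_Icc zero_le_one hφc.continuousOn
    (show s ∈ Set.Icc (φ 0) (φ 1) by rwa [hφ0, hφ1])
  have hmem := mem_numericalRange_of_ne_zero T (hvne t)
  have hnv : ((‖v t‖ ^ 2 : ℝ) : ℂ) ≠ 0 := by
    exact_mod_cast pow_ne_zero 2 (norm_ne_zero_iff.2 (hvne t))
  convert hmem using 1
  have h1 : inner ℂ (v t) (T (v t)) = p * ((‖v t‖ ^ 2 : ℝ) : ℂ) + (q - p) * B (v t) (v t) := by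
    simp only [hB, inner_self_eq_norm_sq_to_K]
    push_cast
    field_simp
    simp
  have h2 : B (v t) (v t) = (s : ℂ) * ((‖v t‖ ^ 2 : ℝ) : ℂ) := by
    rw [hBv t, ← hts, ← Complex.ofReal_mul]
    congr 1
    rw [hφ]
    exact (div_mul_cancel₀ _ (pow_ne_zero 2 (norm_ne_zero_iff.2 (hvne t)))).symm
  change p + s • (q - p) = _
  rw [h1, h2, Complex.real_smul]
  field_simp

/-- A convex set in `ℂ` that meets every open half plane through `0` is a neighbourhood of `0`. -/
lemma zero_mem_interior_of_forall_re_pos {W : Set ℂ} (hW : Convex ℝ W)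
    (h : ∀ u : ℂ, ‖u‖ = 1 → ∃ w ∈ W, 0 < (u * w).re) : (0 : ℂ) ∈ interior W := by
  have hf : ∀ f : ℂ →L[ℝ] ℝ, f ≠ 0 → ∃ w ∈ W, 0 < f w := by
    intro f hf
    set m : ℂ := ⟨f 1, -f Complex.I⟩ with hm
    have hfm : ∀ w : ℂ, f w = (m * w).re := by
      intro w
      have : w = w.re • (1 : ℂ) + w.im • Complex.I := by
        simp [Complex.re_add_im]
      conv_lhs => rw [this]
      rw [map_add, map_smul, map_smul, Complex.mul_re]
      simp [hm]
      ring
    have hm0 : m ≠ 0 := by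
      intro h0
      apply hf
      ext w; simp [hfm, h0]
    have hn : 0 < ‖m‖ := norm_pos_iff.2 hm0
    obtain ⟨w, hw, hpos⟩ := h (m / ‖m‖) (by
      rw [norm_div, Complex.norm_real, norm_norm, div_self hn.ne'])
    refine ⟨w, hw, ?_⟩
    have : m * w = (‖m‖ : ℂ) * (m / ‖m‖ * w) := by
      have : (‖m‖ : ℂ) ≠ 0 := by exact_mod_cast hn.ne'
      field_simp
    rw [hfm, this, Complex.re_ofReal_mul]
    positivity
  -- Otherwise some nonzero functional is constant on `W`, although both it and its negative take
  -- positive values there.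
  have hne : (interior W).Nonempty := by
    rw [hW.interior_nonempty_iff_affineSpan_eq_top]
    by_contra hspan
    obtain ⟨w₀, hw₀, -⟩ := h 1 (by simp)
    have hdir : (affineSpan ℝ W).direction ≠ ⊤ := by
      intro htop
      exact hspan ((AffineSubspace.direction_eq_top_iff_of_nonempty
        ⟨w₀, subset_affineSpan ℝ W hw₀⟩).1 htop)
    obtain ⟨f, hf0, hfle⟩ := Submodule.exists_le_ker_of_lt_top _ (lt_top_iff_ne_top.2 hdir)
    have hconst : ∀ w ∈ W, f w = f w₀ := by
      intro w hw
      have : w -ᵥ w₀ ∈ (affineSpan ℝ W).direction :=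
        AffineSubspace.vsub_mem_direction (subset_affineSpan ℝ W hw) (subset_affineSpan ℝ W hw₀)
      have := hfle this
      rw [LinearMap.mem_ker, vsub_eq_sub, map_sub] at this
      linarith
    have hf0' : LinearMap.toContinuousLinearMap f ≠ 0 := by simpa using hf0
    obtain ⟨w, hw, hpos⟩ := hf _ hf0'
    obtain ⟨w', hw', hneg⟩ := hf _ (neg_ne_zero.2 hf0')
    simp only [LinearMap.coe_toContinuousLinearMap', neg_apply] at hpos hneg
    rw [hconst w hw] at hpos
    rw [hconst w' hw'] at hneg
    linarith
  by_contra h0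
  -- A functional separating `0` from the interior is nonpositive on its closure, which contains
  -- `W`.
  obtain ⟨f, hf1⟩ := geometric_hahn_banach_open_point hW.interior isOpen_interior h0
  have hf0 : f ≠ 0 := by
    rintro rfl
    obtain ⟨w, hw⟩ := hne
    simpa using hf1 w hw
  obtain ⟨w, hw, hpos⟩ := hf f hf0
  have hcl : w ∈ closure (interior W) := by
    rw [hW.closure_interior_eq_closure_of_nonempty_interior hne]
    exact subset_closure hw
  have : f w ≤ f 0 := le_on_closure (fun x hx => (hf1 x hx).le) (by fun_prop) (by fun_prop) hcl
  rw [map_zero] at this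
  linarith

theorem zero_mem_interior_numericalRange (T : H →L[ℂ] H)
    (h : ∀ u : ℂ, ‖u‖ = 1 → ∃ x : H, 0 < (u * inner ℂ x (T x)).re) :
    (0 : ℂ) ∈ interior (numericalRange T) := by
  refine zero_mem_interior_of_forall_re_pos (convex_numericalRange T) fun u hu => ?_
  obtain ⟨x, hx⟩ := h u hu
  have hx0 : x ≠ 0 := by
    rintro rfl
    simp at hx
  refine ⟨_, mem_numericalRange_of_ne_zero T hx0, ?_⟩
  have hn : 0 < ‖x‖ ^ 2 := by positivity
  rw [← mul_div_assoc, Complex.div_ofReal_re]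
  exact div_pos hx hn

lemma inner_compression (T : H →L[ℂ] H) (S : Submodule ℂ H) [S.HasOrthogonalProjection] (x : S) :
    inner ℂ x (compression T S x) = inner ℂ (x : H) (T x) := by
  rw [compression]
  exact Submodule.inner_orthogonalProjectionOnto_eq_of_mem_left x (T x)

end Convexity

/-! ### Integrals over the circle -/

section CircleIntegrals

open AddCircle

lemma continuous_coe_toCircle : Continuous fun x : UnitAddCircle => (toCircle x : ℂ) :=
  continuous_subtype_val.comp continuous_toCircle

lemma norm_toCircle (x : UnitAddCircle) : ‖(toCircle x : ℂ)‖ = 1 := Circle.norm_coe _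

lemma integrable_of_continuous {f : UnitAddCircle → ℂ} (hf : Continuous f) :
    Integrable f haarAddCircle :=
  hf.integrable_of_hasCompactSupport (HasCompactSupport.of_compactSpace f)

/-- The mean value property. -/
lemma integral_toCircle {G : ℂ → ℂ} (hG : ∀ z, ‖z‖ ≤ 1 → DifferentiableAt ℂ G z) :
    ∫ x : UnitAddCircle, G (toCircle x) ∂haarAddCircle = G 0 := by
  have h1 : DiffContOnCl ℂ G (Metric.ball 0 |1|) := by
    refine DifferentiableOn.diffContOnCl fun z hz => (hG z ?_).differentiableWithinAt
    rw [abs_one, closure_ball _ one_ne_zero] at hz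
    simpa using hz
  rw [← h1.circleAverage, Real.circleAverage, integral_haarAddCircle,
    ← UnitAddCircle.intervalIntegral_preimage 0, inv_one, one_smul, zero_add]
  have h2 := intervalIntegral.integral_comp_mul_left (a := 0) (b := 1)
    (fun θ => G (circleMap 0 1 θ)) Real.two_pi_pos.ne'
  rw [mul_zero, mul_one] at h2
  rw [← h2]
  refine intervalIntegral.integral_congr fun t _ => ?_
  simp only [toCircle_apply_mk, Circle.coe_exp, circleMap]
  congr 1
  push_cast
  simp

lemma integral_toCircle_pow_mul {G : ℂ → ℂ} (hG : ∀ z, ‖z‖ ≤ 1 → DifferentiableAt ℂ G z) (n : ℕ) :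
    ∫ x : UnitAddCircle, (toCircle x : ℂ) ^ (n + 1) * G (toCircle x) ∂haarAddCircle = 0 := by
  rw [integral_toCircle (G := fun z => z ^ (n + 1) * G z)
    fun z hz => (differentiableAt_id.pow (n + 1)).mul (hG z hz)]
  simp

lemma differentiableAt_inv_affine {A B : ℂ} (h : ‖B‖ < ‖A‖) (z : ℂ) (hz : ‖z‖ ≤ 1) :
    DifferentiableAt ℂ (fun z => (A + B * z)⁻¹) z :=
  DifferentiableAt.inv (by fun_prop) (affine_ne_zero h hz)

lemma affine_toCircle_ne_zero {A B : ℂ} (h : ‖B‖ < ‖A‖) (x : UnitAddCircle) :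
    A + B * (toCircle x : ℂ) ≠ 0 :=
  affine_ne_zero h (norm_toCircle x).le

lemma continuous_inv_affine {A B : ℂ} (h : ‖B‖ < ‖A‖) :
    Continuous fun x : UnitAddCircle => (A + B * (toCircle x : ℂ))⁻¹ :=
  Continuous.inv₀ (continuous_const.add (continuous_const.mul continuous_coe_toCircle))
    (affine_toCircle_ne_zero h)

lemma integral_conj_pow (n : ℕ) :
    ∫ x : UnitAddCircle, conj (toCircle x : ℂ) ^ (n + 1) ∂haarAddCircle = 0 := by
  have h := integral_toCircle_pow_mul (G := fun _ => 1) (fun z _ => by fun_prop) n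
  simp only [mul_one] at h
  simp only [← map_pow]
  rw [integral_conj, h, map_zero]

/-- This is the `m`-th Taylor coefficient of `(A + B z)⁻¹`. The recursion comes from `A (A + B z)⁻¹
= 1 - B z (A + B z)⁻¹`. -/
lemma integral_conj_pow_mul_inv {A B : ℂ} (h : ‖B‖ < ‖A‖) (m : ℕ) :
    ∫ x : UnitAddCircle, conj (toCircle x : ℂ) ^ m * (A + B * (toCircle x : ℂ))⁻¹ ∂haarAddCircle =
      (-B) ^ m / A ^ (m + 1) := by
  have hA : A ≠ 0 := norm_pos_iff.1 ((norm_nonneg _).trans_lt h)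
  induction m with
  | zero =>
    simp only [pow_zero, one_mul]
    rw [integral_toCircle (G := fun z => (A + B * z)⁻¹) (differentiableAt_inv_affine h)]
    simp
  | succ m ih =>
    have e : ∀ x : UnitAddCircle,
        conj (toCircle x : ℂ) ^ (m + 1) * (A + B * (toCircle x : ℂ))⁻¹ =
          A⁻¹ * conj (toCircle x : ℂ) ^ (m + 1) -
            B / A * (conj (toCircle x : ℂ) ^ m * (A + B * (toCircle x : ℂ))⁻¹) := by
      intro x
      have h1 := conj_mul_self_of_norm_one (norm_toCircle x)
      have h2 := mul_inv_cancel₀ (affine_toCircle_ne_zero h x)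
      have h3 := mul_inv_cancel₀ hA
      simp only [div_eq_mul_inv, pow_succ]
      generalize (A + B * (toCircle x : ℂ))⁻¹ = i at *
      generalize conj (toCircle x : ℂ) = y at *
      linear_combination -(y ^ m * y * i) * h3 + y ^ m * y * A⁻¹ * h2 - B * A⁻¹ * y ^ m * i * h1
    have hc : Continuous fun x : UnitAddCircle => conj (toCircle x : ℂ) :=
      Complex.continuous_conj.comp continuous_coe_toCircle
    simp only [e]
    rw [integral_sub, integral_const_mul, integral_const_mul, integral_conj_pow, ih]
    · rw [mul_zero, zero_sub]
      field_simp
      ring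
    · exact integrable_of_continuous (continuous_const.mul (hc.pow _))
    · exact integrable_of_continuous
        (continuous_const.mul ((hc.pow _).mul (continuous_inv_affine h)))

/-- The decomposition of the Poisson kernel into an analytic and an antianalytic part. -/
lemma poisson_decomposition {A B z : ℂ} (hz : ‖z‖ = 1) (h : A + B * z ≠ 0) :
    ((‖A‖ ^ 2 - ‖B‖ ^ 2 : ℝ) : ℂ) * ((A + B * z)⁻¹ * conj (A + B * z)⁻¹) =
      A * (A + B * z)⁻¹ + conj (A * (A + B * z)⁻¹) - 1 := by
  have hc : conj (A + B * z) ≠ 0 := (map_ne_zero _).2 h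
  have e : ((‖A‖ ^ 2 - ‖B‖ ^ 2 : ℝ) : ℂ) = A * conj A - B * conj B := by
    rw [Complex.mul_conj', Complex.mul_conj']; push_cast; ring
  have e2 : conj (A + B * z) = conj A + conj B * conj z := by simp
  have h1 := conj_mul_self_of_norm_one hz
  have h2 := mul_inv_cancel₀ h
  have h3 := mul_inv_cancel₀ hc
  rw [e2] at h3
  rw [e, map_mul, map_inv₀, e2]
  generalize (A + B * z)⁻¹ = i at *
  generalize (conj A + conj B * conj z)⁻¹ = j at *
  linear_combination A * i * h3 + conj A * j * h2 - (A + B * z) * i * h3 - h2 +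
    B * conj B * i * j * h1

lemma integral_poisson {A B : ℂ} (h : ‖B‖ < ‖A‖) :
    ∫ x : UnitAddCircle, ((‖A‖ ^ 2 - ‖B‖ ^ 2 : ℝ) : ℂ) * ((A + B * (toCircle x : ℂ))⁻¹ *
      conj (A + B * (toCircle x : ℂ))⁻¹) ∂haarAddCircle = 1 := by
  have hA : A ≠ 0 := norm_pos_iff.1 ((norm_nonneg _).trans_lt h)
  have hc := continuous_inv_affine h
  have hi : ∫ x : UnitAddCircle, A * (A + B * (toCircle x : ℂ))⁻¹ ∂haarAddCircle = 1 := by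
    have := integral_conj_pow_mul_inv h 0
    simp only [pow_zero, one_mul, zero_add, pow_one] at this
    rw [integral_const_mul, this, mul_one_div_cancel hA]
  simp only [fun x => poisson_decomposition (norm_toCircle x) (affine_toCircle_ne_zero h x)]
  have i1 : Integrable (fun x : UnitAddCircle => A * (A + B * (toCircle x : ℂ))⁻¹)
      haarAddCircle := integrable_of_continuous (continuous_const.mul hc)
  have i2 : Integrable (fun x : UnitAddCircle => conj (A * (A + B * (toCircle x : ℂ))⁻¹))
      haarAddCircle :=
    integrable_of_continuous (Complex.continuous_conj.comp (continuous_const.mul hc))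
  have i12 : Integrable (fun x : UnitAddCircle => A * (A + B * (toCircle x : ℂ))⁻¹ +
      conj (A * (A + B * (toCircle x : ℂ))⁻¹)) haarAddCircle := i1.add i2
  rw [integral_sub i12 (integrable_const _), integral_add i1 i2, integral_conj, hi]
  simp

/-- Multiplication by `z` kills the mean of the analytic part and leaves the conjugate of the first
Taylor coefficient of `A / (A + B z)`. With `A = a + c z₂` and `B = b + d z₂` this is the focus. -/
lemma integral_mul_poisson {A B : ℂ} (h : ‖B‖ < ‖A‖) :
    ∫ x : UnitAddCircle, (toCircle x : ℂ) * (((‖A‖ ^ 2 - ‖B‖ ^ 2 : ℝ) : ℂ) *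
      ((A + B * (toCircle x : ℂ))⁻¹ * conj (A + B * (toCircle x : ℂ))⁻¹)) ∂haarAddCircle =
        conj (-(B / A)) := by
  have hA : A ≠ 0 := norm_pos_iff.1 ((norm_nonneg _).trans_lt h)
  have hc := continuous_inv_affine h
  have e : ∀ x : UnitAddCircle, (toCircle x : ℂ) * (((‖A‖ ^ 2 - ‖B‖ ^ 2 : ℝ) : ℂ) *
      ((A + B * (toCircle x : ℂ))⁻¹ * conj (A + B * (toCircle x : ℂ))⁻¹)) =
      (toCircle x : ℂ) ^ (0 + 1) * (A * (A + B * (toCircle x : ℂ))⁻¹ - 1) +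
        conj (A * (conj (toCircle x : ℂ) ^ 1 * (A + B * (toCircle x : ℂ))⁻¹)) := by
    intro x
    rw [poisson_decomposition (norm_toCircle x) (affine_toCircle_ne_zero h x)]
    simp only [map_mul, pow_one, zero_add, Complex.conj_conj]
    ring
  have hcz := continuous_coe_toCircle
  have hcc : Continuous fun x : UnitAddCircle => conj (toCircle x : ℂ) :=
    Complex.continuous_conj.comp continuous_coe_toCircle
  simp only [e]
  rw [integral_add, integral_toCircle_pow_mul (G := fun z => A * (A + B * z)⁻¹ - 1), zero_add,
    integral_conj, integral_const_mul, integral_conj_pow_mul_inv h]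
  · congr 1
    field_simp
    ring
  · exact fun z hz => ((differentiableAt_inv_affine h z hz).const_mul A).sub_const 1
  · exact integrable_of_continuous
      ((hcz.pow _).mul ((continuous_const.mul hc).sub continuous_const))
  · exact integrable_of_continuous
      (Complex.continuous_conj.comp (continuous_const.mul ((hcc.pow _).mul hc)))

lemma fourier_natCast_apply (n : ℕ) (x : UnitAddCircle) :
    fourier (n : ℤ) x = (toCircle x : ℂ) ^ n := by
  rw [fourier_apply, toCircle_zsmul]
  simp

lemma fourier_neg_natCast_apply (n : ℕ) (x : UnitAddCircle) :
    fourier (-(n : ℤ)) x = conj (toCircle x : ℂ) ^ n := by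
  rw [fourier_neg, fourier_natCast_apply, map_pow]

lemma ae_toCircle_ne (τ : ℂ) :
    ∀ᵐ y : UnitAddCircle ∂haarAddCircle, (toCircle y : ℂ) ≠ τ := by
  have hs : ({y : UnitAddCircle | (toCircle y : ℂ) = τ}).Subsingleton := by
    intro y hy y' hy'
    exact injective_toCircle one_ne_zero (Circle.ext (Eq.trans hy (Eq.symm hy')))
  have hv : (volume : Measure UnitAddCircle) {y : UnitAddCircle | (toCircle y : ℂ) = τ} = 0 := by
    rcases hs.eq_empty_or_singleton with h | ⟨x, h⟩
    · rw [h, measure_empty]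
    · rw [h, ← Metric.closedBall_zero, volume_closedBall]
      simp
  rw [volume_eq_smul_haarAddCircle, ENNReal.ofReal_one, one_smul] at hv
  exact compl_mem_ae_iff.2 hv

/-- Poisson kernels are an approximate identity. -/
lemma tendsto_integral_poisson {Φ : UnitAddCircle → ℂ} (hΦ : Continuous Φ) (y₀ : UnitAddCircle) :
    Filter.Tendsto (fun r : ℝ => ∫ y : UnitAddCircle,
      ((1 - r ^ 2) * ‖(1 - (toCircle y : ℂ) * conj ((r : ℂ) * toCircle y₀))⁻¹‖ ^ 2) • Φ y
        ∂haarAddCircle) (nhdsWithin 1 (Set.Iio 1)) (nhds (Φ y₀)) := by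
  have hI : ∀ᶠ r : ℝ in nhdsWithin 1 (Set.Iio 1), 0 < r ∧ r < 1 := by
    filter_upwards [Ioo_mem_nhdsLT (zero_lt_one' ℝ)] with r hr using hr
  have hB : ∀ r : ℝ, 0 < r ∧ r < 1 → ‖-conj ((r : ℂ) * toCircle y₀)‖ < ‖(1 : ℂ)‖ := by
    intro r hr
    rw [norm_neg, RCLike.norm_conj, norm_mul, norm_toCircle, Complex.norm_real,
      Real.norm_of_nonneg hr.1.le, norm_one, mul_one]
    exact hr.2
  have hrw : ∀ (r : ℝ) (y : UnitAddCircle), 1 - (toCircle y : ℂ) * conj ((r : ℂ) * toCircle y₀) =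
      1 + (-conj ((r : ℂ) * toCircle y₀)) * toCircle y := fun r y => by ring
  refine tendsto_integral_peak_smul_of_integrable_of_tendsto (t := Set.univ) MeasurableSet.univ
    Filter.univ_mem (by finiteness) ?_ ?_ ?_ ?_ (integrable_of_continuous hΦ) hΦ.continuousAt
  · filter_upwards [hI] with r hr y
    have : 0 ≤ 1 - r ^ 2 := by nlinarith
    positivity
  · intro U hU hy₀
    obtain ⟨ε, hε, hle⟩ := hU.isClosed_compl.isCompact.exists_forall_le' (a := 0)
      (f := fun y : UnitAddCircle => ‖(toCircle y : ℂ) - toCircle y₀‖)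
      ((continuous_coe_toCircle.sub continuous_const).norm.continuousOn) (by
        intro y hy
        refine norm_pos_iff.2 (sub_ne_zero.2 fun h => hy ?_)
        rwa [injective_toCircle one_ne_zero (Circle.ext h)])
    rw [Metric.tendstoUniformlyOn_iff]
    intro η hη
    -- Outside `U` one has `ε ≤ |y - y₀| ≤ |y₀ - r y| + (1 - r)`; so once `1 - r < ε / 2`, the Szegő
    -- factor is at most `2 / ε`.
    have hlim : Filter.Tendsto (fun r : ℝ => (1 - r ^ 2) * (2 / ε) ^ 2)
        (nhdsWithin 1 (Set.Iio 1)) (nhds 0) := by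
      have : Continuous fun r : ℝ => (1 - r ^ 2) * (2 / ε) ^ 2 := by fun_prop
      have h := this.tendsto 1
      rw [one_pow, sub_self, zero_mul] at h
      exact h.mono_left nhdsWithin_le_nhds
    have hclose : ∀ᶠ r : ℝ in nhdsWithin 1 (Set.Iio 1), 1 - ε / 2 < r :=
      nhdsWithin_le_nhds (Ioi_mem_nhds (by linarith))
    filter_upwards [hI, hclose, hlim.eventually (gt_mem_nhds hη)] with r hr hrε hrη y hy
    have h1 : 0 ≤ 1 - r ^ 2 := by nlinarith
    rw [Pi.zero_apply, dist_zero_left, Real.norm_of_nonneg (by positivity)]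
    refine lt_of_le_of_lt ?_ hrη
    gcongr
    have h2 : ‖1 - (toCircle y : ℂ) * conj ((r : ℂ) * toCircle y₀)‖ =
        ‖(toCircle y₀ : ℂ) - r * toCircle y‖ := by
      have : (toCircle y₀ : ℂ) - r * toCircle y =
          toCircle y₀ * (1 - (toCircle y : ℂ) * conj ((r : ℂ) * toCircle y₀)) := by
        rw [map_mul, Complex.conj_ofReal]
        linear_combination (r * toCircle y : ℂ) * conj_mul_self_of_norm_one (norm_toCircle y₀)
      rw [this, norm_mul, norm_toCircle, one_mul]
    have h3 : ε / 2 ≤ ‖(toCircle y₀ : ℂ) - r * toCircle y‖ := by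
      have h4 : ‖(toCircle y : ℂ) - toCircle y₀‖ ≤
          ‖(toCircle y₀ : ℂ) - r * toCircle y‖ + ‖((1 - r : ℝ) : ℂ) * toCircle y‖ := by
        rw [norm_sub_rev (toCircle y₀ : ℂ)]
        refine le_trans (le_of_eq ?_) (norm_add_le _ _)
        congr 1
        push_cast
        ring
      rw [norm_mul, norm_toCircle, Complex.norm_real, mul_one,
        Real.norm_of_nonneg (by linarith)] at h4
      have : ε ≤ ‖(toCircle y : ℂ) - toCircle y₀‖ := hle y hy
      linarith
    rw [norm_inv, h2, ← inv_div]
    exact inv_anti₀ (by positivity) h3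
  · refine tendsto_const_nhds.congr' ?_
    filter_upwards [hI] with r hr
    have h := integral_poisson (hB r hr)
    rw [Measure.restrict_univ]
    apply Complex.ofReal_injective
    rw [← integral_complex_ofReal, Complex.ofReal_one]
    refine h.symm.trans (integral_congr_ae (Filter.Eventually.of_forall fun y => ?_))
    beta_reduce
    rw [Complex.mul_conj', norm_neg, RCLike.norm_conj, norm_mul, norm_toCircle,
      Complex.norm_real, Real.norm_of_nonneg hr.1.le, norm_one, mul_one, hrw]
    push_cast
    ring
  · filter_upwards [hI] with r hr
    simp only [hrw]
    exact (continuous_const.mul ((continuous_inv_affine (hB r hr)).norm.pow 2)).aestronglyMeasurable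

end CircleIntegrals

/-! ### Slices of the functions on the torus -/

section Slices

open AddCircle

/-- The consequences of the hypotheses on one factor that the integrals need. -/
structure IsFactor (a b c d τ : ℂ) : Prop where
  det : a * d ≠ b * c
  lt : ‖c‖ < ‖a‖
  kappa : conj a * c - d * conj b ≠ 0
  norm_tau : ‖τ‖ = 1
  sub_eq : ∀ z : ℂ, ‖z‖ = 1 →
    ‖a + c * z‖ ^ 2 - ‖b + d * z‖ ^ 2 = ‖conj a * c - d * conj b‖ * ‖z - τ‖ ^ 2

lemma isFactor {a b c d τ₁ τ₂ : ℂ} (h : IsInnerOneOne a b c d) (hτ₁ : ‖τ₁‖ = 1) (hτ₂ : ‖τ₂‖ = 1)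
    (hzero : pval a b c d (τ₁, τ₂) = 0) : IsFactor a b c d τ₂ where
  det := det_ne_zero h hτ₁ hτ₂ hzero
  lt := norm_c_lt_norm_a h.1 (det_ne_zero h hτ₁ hτ₂ hzero)
  kappa := kappa_ne_zero h hτ₁ hτ₂ hzero
  norm_tau := hτ₂
  sub_eq _ hz := normSq_sub_eq h.1 hτ₁ hτ₂ hzero hz

variable {a b c d τ a' b' c' d' τ' : ℂ}

lemma pval_slice (a b c d z₁ z₂ : ℂ) :
    pval a b c d (z₁, z₂) = (a + c * z₂) + (b + d * z₂) * z₁ := by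
  rw [pval_eq]; ring

lemma fBasis_slice (a b c d τ z₁ z₂ : ℂ) :
    fBasis a b c d τ (z₁, z₂) = (Real.sqrt ‖conj a * c - d * conj b‖ : ℂ) * (z₂ - τ) *
      ((a + c * z₂) + (b + d * z₂) * z₁)⁻¹ := by
  rw [fBasis, pval_slice, div_eq_mul_inv]

/-- On the torus the reflection is `z₁ z₂` times the conjugate. -/
lemma pReflVal_of_norm_one {z₁ z₂ : ℂ} (h₁ : ‖z₁‖ = 1) (h₂ : ‖z₂‖ = 1) :
    pReflVal a b c d (z₁, z₂) = z₁ * z₂ * conj (pval a b c d (z₁, z₂)) := by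
  have e₁ := conj_mul_self_of_norm_one h₁
  have e₂ := conj_mul_self_of_norm_one h₂
  rw [pReflVal_eq, pval_eq]
  simp only [map_add, map_mul]
  linear_combination (-conj b * z₂ - conj d * conj z₂ * z₂) * e₁ + (-conj c * z₁ - conj d) * e₂

lemma norm_theta_le {z₁ z₂ : ℂ} (h₁ : ‖z₁‖ = 1) (h₂ : ‖z₂‖ = 1) :
    ‖theta a b c d (z₁, z₂)‖ ≤ 1 := by
  rw [theta, pReflVal_of_norm_one h₁ h₂, norm_div, norm_mul, norm_mul, h₁, h₂, RCLike.norm_conj,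
    one_mul, one_mul]
  exact div_self_le_one _

lemma IsFactor.slice_lt (h : IsFactor a b c d τ) {z : ℂ} (hz : ‖z‖ = 1) (hzτ : z ≠ τ) :
    ‖b + d * z‖ < ‖a + c * z‖ := by
  have h1 := h.sub_eq z hz
  have h2 : 0 < ‖conj a * c - d * conj b‖ * ‖z - τ‖ ^ 2 :=
    mul_pos (norm_pos_iff.2 h.kappa) (pow_pos (norm_pos_iff.2 (sub_ne_zero.2 hzτ)) 2)
  exact lt_of_pow_lt_pow_left₀ 2 (norm_nonneg _) (by linarith)

lemma sqrt_mul_self_complex {t : ℝ} (ht : 0 ≤ t) :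
    (Real.sqrt t : ℂ) * (Real.sqrt t : ℂ) = t := by
  rw [← Complex.ofReal_mul, Real.mul_self_sqrt ht]

/-- The factor `|κ| |z₂ - τ|²` is exactly the numerator that turns `|1 / p|²` into a Poisson kernel
in `z₁`. -/
lemma IsFactor.fBasis_mul_conj (h : IsFactor a b c d τ) (z₁ : ℂ) {z₂ : ℂ} (h₂ : ‖z₂‖ = 1) :
    fBasis a b c d τ (z₁, z₂) * conj (fBasis a b c d τ (z₁, z₂)) =
      ((‖a + c * z₂‖ ^ 2 - ‖b + d * z₂‖ ^ 2 : ℝ) : ℂ) *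
        (((a + c * z₂) + (b + d * z₂) * z₁)⁻¹ * conj ((a + c * z₂) + (b + d * z₂) * z₁)⁻¹) := by
  have e := sqrt_mul_self_complex (norm_nonneg (conj a * c - d * conj b))
  have e' : (z₂ - τ) * conj (z₂ - τ) = (‖z₂ - τ‖ : ℂ) ^ 2 := Complex.mul_conj' _
  rw [h.sub_eq z₂ h₂, fBasis_slice]
  simp only [map_mul, Complex.conj_ofReal, Complex.ofReal_mul, Complex.ofReal_pow]
  generalize conj ((a + c * z₂) + (b + d * z₂) * z₁)⁻¹ = j
  generalize ((a + c * z₂) + (b + d * z₂) * z₁)⁻¹ = i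
  linear_combination (z₂ - τ) * conj (z₂ - τ) * i * j * e +
    (‖conj a * c - d * conj b‖ : ℂ) * i * j * e'

/-! ### The matrix symbol -/

/-- The off-diagonal entry of the symbol. -/
def offDiag (a b c d τ a' b' c' d' τ' : ℂ) (z : ℂ) : ℂ :=
  (Real.sqrt ‖conj a * c - d * conj b‖ : ℂ) * (Real.sqrt ‖conj a' * c' - d' * conj b'‖ : ℂ) *
    (z - τ) * conj (z - τ') * conj z * conj ((a + c * z)⁻¹ * (a' + c' * z)⁻¹)

lemma IsFactor.one_sub_focus (h : IsFactor a b c d τ) {z : ℂ} (hz : ‖z‖ = 1) :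
    1 - ‖focus a b c d z‖ ^ 2 =
      ‖conj a * c - d * conj b‖ * ‖z - τ‖ ^ 2 / ‖a + c * z‖ ^ 2 := by
  have hA := norm_ne_zero_iff.2 (affine_ne_zero h.lt hz.le)
  rw [← h.sub_eq z hz, focus, RCLike.norm_conj, norm_neg, norm_div]
  generalize ‖a + c * z‖ = x at *
  field_simp

lemma norm_offDiag_sq (h : IsFactor a b c d τ) (h' : IsFactor a' b' c' d' τ') {z : ℂ}
    (hz : ‖z‖ = 1) : ‖offDiag a b c d τ a' b' c' d' τ' z‖ ^ 2 =
      (1 - ‖focus a b c d z‖ ^ 2) * (1 - ‖focus a' b' c' d' z‖ ^ 2) := by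
  rw [h.one_sub_focus hz, h'.one_sub_focus hz, offDiag]
  simp only [norm_mul, RCLike.norm_conj, norm_inv, hz, Complex.norm_real, Real.norm_eq_abs,
    mul_pow, sq_abs, Real.sq_sqrt (norm_nonneg _), inv_pow]
  ring

/-- The quadratic form of the `2 × 2` matrix valued symbol. -/
def symbolForm (a b c d τ a' b' c' d' τ' v₁ v₂ : ℂ) (z : ℂ) : ℂ :=
  focus a b c d z * (v₁ * conj v₁) + focus a' b' c' d' z * (v₂ * conj v₂) +
    offDiag a b c d τ a' b' c' d' τ' z * (v₁ * conj v₂)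

/-- The slice integrals are computed only away from `τ` and `τ'`, but the resulting formula has only
`a + c z` and `a' + c' z` in its denominators and so is continuous on the whole circle. Its values
at `τ` and `τ'` can therefore be approximated too. -/
lemma continuous_symbolForm (h : IsFactor a b c d τ) (h' : IsFactor a' b' c' d' τ') (v₁ v₂ : ℂ) :
    Continuous fun y : UnitAddCircle =>
      symbolForm a b c d τ a' b' c' d' τ' v₁ v₂ (toCircle y) := by
  have hc := continuous_coe_toCircle
  have h1 := continuous_inv_affine h.lt
  have h2 := continuous_inv_affine h'.lt
  have hf : ∀ {a b c d : ℂ}, Continuous (fun x : UnitAddCircle => (a + c * (toCircle x : ℂ))⁻¹) →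
      Continuous fun y : UnitAddCircle => focus a b c d (toCircle y) := by
    intro a b c d h
    simp only [focus, div_eq_mul_inv]
    exact Complex.continuous_conj.comp
      ((continuous_const.add (continuous_const.mul hc)).mul h).neg
  have ho : Continuous fun y : UnitAddCircle =>
      offDiag a b c d τ a' b' c' d' τ' (toCircle y) := by
    unfold offDiag
    exact (((continuous_const.mul (hc.sub continuous_const)).mul
      (Complex.continuous_conj.comp (hc.sub continuous_const))).mul
      (Complex.continuous_conj.comp hc)).mul (Complex.continuous_conj.comp (h1.mul h2))
  exact (((hf h1).mul continuous_const).add ((hf h2).mul continuous_const)).add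
    (ho.mul continuous_const)

/-- The generating function of an element of `𝓢₂`. -/
def pairFun (a b c d τ a' b' c' d' τ' v₁ v₂ : ℂ) (z : ℂ × ℂ) : ℂ :=
  v₁ * fBasis a b c d τ z + v₂ * (theta a b c d z * fBasis a' b' c' d' τ' z)

/-- On the torus `θ = z₁ z₂ conj p / p` is unimodular. The diagonal terms are therefore Poisson
kernels. In the cross terms `θ` cancels one denominator and replaces it by its conjugate: one
becomes antianalytic in `z₁`, the other `z₁²` times an analytic function. -/
lemma pairFun_expansion (h : IsFactor a b c d τ) (h' : IsFactor a' b' c' d' τ') (v₁ v₂ : ℂ)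
    {z₁ z₂ : ℂ} (h₁ : ‖z₁‖ = 1) (h₂ : ‖z₂‖ = 1) (hz : z₂ ≠ τ) :
    z₁ * (pairFun a b c d τ a' b' c' d' τ' v₁ v₂ (z₁, z₂) *
        conj (pairFun a b c d τ a' b' c' d' τ' v₁ v₂ (z₁, z₂))) =
      v₁ * conj v₁ * (z₁ * (((‖a + c * z₂‖ ^ 2 - ‖b + d * z₂‖ ^ 2 : ℝ) : ℂ) *
        (((a + c * z₂) + (b + d * z₂) * z₁)⁻¹ * conj ((a + c * z₂) + (b + d * z₂) * z₁)⁻¹))) +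
      v₂ * conj v₂ * (z₁ * (((‖a' + c' * z₂‖ ^ 2 - ‖b' + d' * z₂‖ ^ 2 : ℝ) : ℂ) *
        (((a' + c' * z₂) + (b' + d' * z₂) * z₁)⁻¹ *
          conj ((a' + c' * z₂) + (b' + d' * z₂) * z₁)⁻¹))) +
      v₁ * conj v₂ * ((Real.sqrt ‖conj a * c - d * conj b‖ : ℂ) *
        (Real.sqrt ‖conj a' * c' - d' * conj b'‖ : ℂ) * (z₂ - τ) * conj (z₂ - τ') * conj z₂ *
        conj (((a + c * z₂) + (b + d * z₂) * z₁)⁻¹ * ((a' + c' * z₂) + (b' + d' * z₂) * z₁)⁻¹)) +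
      v₂ * conj v₁ * ((Real.sqrt ‖conj a * c - d * conj b‖ : ℂ) *
        (Real.sqrt ‖conj a' * c' - d' * conj b'‖ : ℂ) * conj (z₂ - τ) * (z₂ - τ') * z₂ *
        (z₁ ^ (1 + 1) *
          (((a + c * z₂) + (b + d * z₂) * z₁)⁻¹ * ((a' + c' * z₂) + (b' + d' * z₂) * z₁)⁻¹))) := by
  have hp : (a + c * z₂) + (b + d * z₂) * z₁ ≠ 0 := affine_ne_zero (h.slice_lt h₂ hz) h₁.le
  have e₁ := conj_mul_self_of_norm_one h₁
  have e₂ := conj_mul_self_of_norm_one h₂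
  have hθ : theta a b c d (z₁, z₂) = z₁ * z₂ * conj ((a + c * z₂) + (b + d * z₂) * z₁) *
      ((a + c * z₂) + (b + d * z₂) * z₁)⁻¹ := by
    rw [theta, pReflVal_of_norm_one h₁ h₂, pval_slice, div_eq_mul_inv]
  have q1 := mul_inv_cancel₀ hp
  have q2 := mul_inv_cancel₀ ((map_ne_zero conj).2 hp)
  have hθc : conj (theta a b c d (z₁, z₂)) = conj z₁ * conj z₂ *
      ((a + c * z₂) + (b + d * z₂) * z₁) * conj ((a + c * z₂) + (b + d * z₂) * z₁)⁻¹ := by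
    rw [hθ, map_mul, map_mul, map_mul, Complex.conj_conj]
  have hfc : conj (fBasis a b c d τ (z₁, z₂)) = (Real.sqrt ‖conj a * c - d * conj b‖ : ℂ) *
      conj (z₂ - τ) * conj ((a + c * z₂) + (b + d * z₂) * z₁)⁻¹ := by
    rw [fBasis_slice, map_mul, map_mul, Complex.conj_ofReal]
  have hfc' : conj (fBasis a' b' c' d' τ' (z₁, z₂)) =
      (Real.sqrt ‖conj a' * c' - d' * conj b'‖ : ℂ) *
      conj (z₂ - τ') * conj ((a' + c' * z₂) + (b' + d' * z₂) * z₁)⁻¹ := by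
    rw [fBasis_slice, map_mul, map_mul, Complex.conj_ofReal]
  have hθθ : theta a b c d (z₁, z₂) * conj (theta a b c d (z₁, z₂)) = 1 := by
    rw [hθc, hθ, map_inv₀]
    generalize (a + c * z₂) + (b + d * z₂) * z₁ = P at *
    generalize conj P = Q at *
    linear_combination (conj z₂ * z₂ * P * P⁻¹ * Q * Q⁻¹) * e₁ + (P * P⁻¹ * Q * Q⁻¹) * e₂ +
      Q * Q⁻¹ * q1 + q2
  have h2 : z₁ * (fBasis a b c d τ (z₁, z₂) * conj (theta a b c d (z₁, z₂)) *
      conj (fBasis a' b' c' d' τ' (z₁, z₂))) =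
      (Real.sqrt ‖conj a * c - d * conj b‖ : ℂ) *
        (Real.sqrt ‖conj a' * c' - d' * conj b'‖ : ℂ) * (z₂ - τ) * conj (z₂ - τ') * conj z₂ *
        conj (((a + c * z₂) + (b + d * z₂) * z₁)⁻¹ *
          ((a' + c' * z₂) + (b' + d' * z₂) * z₁)⁻¹) := by
    rw [hfc', hθc, fBasis_slice, map_mul conj (_⁻¹)]
    generalize (a + c * z₂) + (b + d * z₂) * z₁ = P at *
    generalize conj P⁻¹ = j
    generalize conj ((a' + c' * z₂) + (b' + d' * z₂) * z₁)⁻¹ = j'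
    generalize (Real.sqrt ‖conj a * c - d * conj b‖ : ℂ) = L
    generalize (Real.sqrt ‖conj a' * c' - d' * conj b'‖ : ℂ) = L'
    linear_combination L * L' * (z₂ - τ) * conj (z₂ - τ') * conj z₂ * j * j' *
      (P * P⁻¹ * e₁ + q1)
  have h3 : z₁ * (theta a b c d (z₁, z₂) * fBasis a' b' c' d' τ' (z₁, z₂) *
      conj (fBasis a b c d τ (z₁, z₂))) =
      (Real.sqrt ‖conj a * c - d * conj b‖ : ℂ) *
        (Real.sqrt ‖conj a' * c' - d' * conj b'‖ : ℂ) * conj (z₂ - τ) * (z₂ - τ') * z₂ *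
        (z₁ ^ (1 + 1) * (((a + c * z₂) + (b + d * z₂) * z₁)⁻¹ *
          ((a' + c' * z₂) + (b' + d' * z₂) * z₁)⁻¹)) := by
    rw [hfc, hθ, fBasis_slice, map_inv₀]
    generalize (a + c * z₂) + (b + d * z₂) * z₁ = P at *
    generalize conj P = Q at *
    generalize ((a' + c' * z₂) + (b' + d' * z₂) * z₁)⁻¹ = i'
    generalize (Real.sqrt ‖conj a * c - d * conj b‖ : ℂ) = L
    generalize (Real.sqrt ‖conj a' * c' - d' * conj b'‖ : ℂ) = L'
    linear_combination L * L' * conj (z₂ - τ) * (z₂ - τ') * z₂ * z₁ ^ 2 * P⁻¹ * i' * q2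
  rw [← h.fBasis_mul_conj z₁ h₂, ← h'.fBasis_mul_conj z₁ h₂, pairFun, ← h2, ← h3]
  simp only [map_add, map_mul]
  linear_combination v₂ * conj v₂ * z₁ * fBasis a' b' c' d' τ' (z₁, z₂) *
    conj (fBasis a' b' c' d' τ' (z₁, z₂)) * hθθ

/-- The antianalytic cross term contributes its value at `z₁ = 0`, the other cross term integrates
to zero; hence the symbol is triangular. -/
lemma integral_slice_pairFun (h : IsFactor a b c d τ) (h' : IsFactor a' b' c' d' τ') (v₁ v₂ : ℂ)
    {z : ℂ} (hz : ‖z‖ = 1) (hzτ : z ≠ τ) (hzτ' : z ≠ τ') :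
    ∫ x : UnitAddCircle, (toCircle x : ℂ) *
      (pairFun a b c d τ a' b' c' d' τ' v₁ v₂ (toCircle x, z) *
        conj (pairFun a b c d τ a' b' c' d' τ' v₁ v₂ (toCircle x, z))) ∂haarAddCircle =
      symbolForm a b c d τ a' b' c' d' τ' v₁ v₂ z := by
  have hlt := h.slice_lt hz hzτ
  have hlt' := h'.slice_lt hz hzτ'
  have hc := continuous_coe_toCircle
  have h1 := continuous_inv_affine hlt
  have h2 := continuous_inv_affine hlt'
  have hdiff : ∀ w : ℂ, ‖w‖ ≤ 1 → DifferentiableAt ℂ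
      (fun w => ((a + c * z) + (b + d * z) * w)⁻¹ * ((a' + c' * z) + (b' + d' * z) * w)⁻¹) w :=
    fun w hw => (differentiableAt_inv_affine hlt w hw).mul (differentiableAt_inv_affine hlt' w hw)
  have i1 : Integrable (fun x : UnitAddCircle => (toCircle x : ℂ) *
      (((‖a + c * z‖ ^ 2 - ‖b + d * z‖ ^ 2 : ℝ) : ℂ) *
        (((a + c * z) + (b + d * z) * (toCircle x : ℂ))⁻¹ *
          conj ((a + c * z) + (b + d * z) * (toCircle x : ℂ))⁻¹))) haarAddCircle :=
    integrable_of_continuous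
      (hc.mul (continuous_const.mul (h1.mul (Complex.continuous_conj.comp h1))))
  have i2 : Integrable (fun x : UnitAddCircle => (toCircle x : ℂ) *
      (((‖a' + c' * z‖ ^ 2 - ‖b' + d' * z‖ ^ 2 : ℝ) : ℂ) *
        (((a' + c' * z) + (b' + d' * z) * (toCircle x : ℂ))⁻¹ *
          conj ((a' + c' * z) + (b' + d' * z) * (toCircle x : ℂ))⁻¹))) haarAddCircle :=
    integrable_of_continuous
      (hc.mul (continuous_const.mul (h2.mul (Complex.continuous_conj.comp h2))))
  have i3 : Integrable (fun x : UnitAddCircle =>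
      conj (((a + c * z) + (b + d * z) * (toCircle x : ℂ))⁻¹ *
        ((a' + c' * z) + (b' + d' * z) * (toCircle x : ℂ))⁻¹)) haarAddCircle :=
    integrable_of_continuous (Complex.continuous_conj.comp (h1.mul h2))
  have i4 : Integrable (fun x : UnitAddCircle => (toCircle x : ℂ) ^ (1 + 1) *
      (((a + c * z) + (b + d * z) * (toCircle x : ℂ))⁻¹ *
        ((a' + c' * z) + (b' + d' * z) * (toCircle x : ℂ))⁻¹)) haarAddCircle :=
    integrable_of_continuous ((hc.pow (1 + 1)).mul (h1.mul h2))
  have hconj : ∫ x : UnitAddCircle, conj (((a + c * z) + (b + d * z) * (toCircle x : ℂ))⁻¹ *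
      ((a' + c' * z) + (b' + d' * z) * (toCircle x : ℂ))⁻¹) ∂haarAddCircle =
        conj ((a + c * z)⁻¹ * (a' + c' * z)⁻¹) := by
    rw [integral_conj, integral_toCircle hdiff]
    simp
  have hzero := integral_toCircle_pow_mul hdiff 1
  simp only [fun x => pairFun_expansion h h' v₁ v₂ (norm_toCircle x) hz hzτ]
  refine (integral_add (((i1.const_mul _).add (i2.const_mul _)).add
    ((i3.const_mul _).const_mul _)) ((i4.const_mul _).const_mul _)).trans ?_
  refine (congrArg₂ (· + ·) ((integral_add ((i1.const_mul _).add (i2.const_mul _))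
    ((i3.const_mul _).const_mul _)).trans (congrArg₂ (· + ·)
      (integral_add (i1.const_mul _) (i2.const_mul _)) rfl)) rfl).trans ?_
  simp only [integral_const_mul]
  rw [hconj, hzero, integral_mul_poisson hlt, integral_mul_poisson hlt']
  simp only [symbolForm, offDiag, focus]
  ring

/-! ### Elements of the model space -/

lemma continuous_pt : Continuous pt :=
  (continuous_coe_toCircle.comp continuous_fst).prodMk (continuous_coe_toCircle.comp continuous_snd)

lemma pt_mk (x y : UnitAddCircle) : pt (x, y) = ((toCircle x : ℂ), (toCircle y : ℂ)) := rfl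

lemma measurable_pval : Measurable fun x : Torus => pval a b c d (pt x) := by
  simp only [pval_eq]
  have := continuous_pt
  exact Continuous.measurable (by fun_prop)

lemma measurable_fBasis : Measurable fun x : Torus => fBasis a b c d τ (pt x) := by
  unfold fBasis
  have := continuous_pt
  exact Measurable.div (Continuous.measurable (by fun_prop)) measurable_pval

lemma measurable_theta : Measurable fun x : Torus => theta a b c d (pt x) := by
  unfold theta
  refine Measurable.div ?_ measurable_pval
  simp only [pReflVal_eq]
  have := continuous_pt
  exact Continuous.measurable (by fun_prop)

/-- By Tonelli: for almost every `z₂` the slice of `|f|²` is a Poisson kernel of mean `1`. -/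
lemma memLp_fBasis (h : IsFactor a b c d τ) :
    MemLp (fun x : Torus => fBasis a b c d τ (pt x)) 2 torusMeasure := by
  have hm : Measurable fun x : Torus => fBasis a b c d τ (pt x) := measurable_fBasis
  rw [memLp_two_iff_integrable_sq_norm hm.aestronglyMeasurable,
    integrable_prod_iff' (hm.norm.pow_const 2).aestronglyMeasurable]
  have key : ∀ x y : UnitAddCircle, ((‖fBasis a b c d τ (pt (x, y))‖ ^ 2 : ℝ) : ℂ) =
      ((‖a + c * toCircle y‖ ^ 2 - ‖b + d * toCircle y‖ ^ 2 : ℝ) : ℂ) *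
        (((a + c * toCircle y) + (b + d * toCircle y) * (toCircle x : ℂ))⁻¹ *
          conj ((a + c * toCircle y) + (b + d * toCircle y) * (toCircle x : ℂ))⁻¹) := by
    intro x y
    rw [← h.fBasis_mul_conj _ (norm_toCircle y), Complex.mul_conj', pt_mk]
    push_cast
    rfl
  constructor
  · filter_upwards [ae_toCircle_ne τ] with y hy
    have hc := continuous_inv_affine (h.slice_lt (norm_toCircle y) hy)
    have hi := integrable_of_continuous ((continuous_const
      (y := ((‖a + c * toCircle y‖ ^ 2 - ‖b + d * toCircle y‖ ^ 2 : ℝ) : ℂ))).mul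
        (hc.mul (Complex.continuous_conj.comp hc)))
    refine (hi.congr (Filter.Eventually.of_forall fun x => (key x y).symm)).re.congr
      (Filter.Eventually.of_forall fun x => ?_)
    exact Complex.ofReal_re _
  · refine (integrable_const (1 : ℝ)).congr ?_
    filter_upwards [ae_toCircle_ne τ] with y hy
    apply Complex.ofReal_injective
    rw [← integral_complex_ofReal, Complex.ofReal_one,
      ← integral_poisson (h.slice_lt (norm_toCircle y) hy)]
    refine integral_congr_ae (Filter.Eventually.of_forall fun x => ?_)
    beta_reduce
    rw [← key, norm_pow, norm_norm]

/-- The Szegő kernel in the second variable. -/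
def szego (s z : ℂ) : ℂ := (1 - z * conj s)⁻¹

lemma one_sub_ne_zero {s z : ℂ} (hs : ‖s‖ < 1) (hz : ‖z‖ ≤ 1) : 1 - z * conj s ≠ 0 := by
  have := affine_ne_zero (a := 1) (c := -conj s) (by simpa using hs) hz
  rwa [neg_mul, ← sub_eq_add_neg, mul_comm] at this

lemma continuous_szego {s : ℂ} (hs : ‖s‖ < 1) :
    Continuous fun y : UnitAddCircle => szego s (toCircle y) :=
  Continuous.inv₀ (continuous_const.sub (continuous_coe_toCircle.mul continuous_const))
    fun y => one_sub_ne_zero hs (norm_toCircle y).le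

lemma memLp_mul_szego {F : Torus → ℂ} (hF : MemLp F 2 torusMeasure) {s : ℂ} (hs : ‖s‖ < 1) :
    MemLp (fun x : Torus => F x * szego s (pt x).2) 2 torusMeasure := by
  obtain ⟨C, hC⟩ := (isCompact_range (continuous_szego hs)).isBounded.exists_norm_le
  refine hF.of_le_mul (c := C) (hF.1.mul ?_) (Filter.Eventually.of_forall fun x => ?_)
  · exact ((continuous_szego hs).comp continuous_snd).aestronglyMeasurable
  · rw [norm_mul, mul_comm]
    gcongr
    exact hC _ ⟨x.2, rfl⟩

lemma fourierCoeffTorus_congr {F : L2Torus} {G : Torus → ℂ} (h : F =ᵐ[torusMeasure] G) (m n : ℤ) :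
    fourierCoeffTorus F m n =
      ∫ y, ∫ x, fourier (-m) x * fourier (-n) y * G (x, y) ∂haarAddCircle
        ∂haarAddCircle := by
  have hae : (fun x : Torus => fourier (-m) x.1 * fourier (-n) x.2 * F x) =ᵐ[torusMeasure]
      fun x => fourier (-m) x.1 * fourier (-n) x.2 * G x := by
    filter_upwards [h] with x hx
    rw [hx]
  rw [fourierCoeffTorus, integral_congr_ae hae]
  exact integral_prod_symm _ ((integrable_fourier_mul F m n).congr hae)

/-- For `m < 0` the `z₁`-integral already vanishes, almost every slice being analytic. For `m ≥ 0`
it yields the Taylor coefficient `(-(b + d z₂))^m / (a + c z₂)^(m + 1)`, analytic across the closed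
disk because `‖c‖ < ‖a‖`, so negative `n` give zero. -/
lemma mem_hardy_of_ae_eq (h : IsFactor a b c d τ) {s : ℂ} (hs : ‖s‖ < 1) (C : ℂ) {F : L2Torus}
    (hF : F =ᵐ[torusMeasure] fun x => C * (fBasis a b c d τ (pt x) * szego s (pt x).2)) :
    F ∈ hardy := by
  intro m n hmn
  rw [fourierCoeffTorus_congr hF]
  have hinner : ∀ y : UnitAddCircle, ∫ x : UnitAddCircle, fourier (-m) x * fourier (-n) y *
      (C * (fBasis a b c d τ (pt (x, y)) * szego s (pt (x, y)).2)) ∂haarAddCircle =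
      fourier (-n) y * (C * ((Real.sqrt ‖conj a * c - d * conj b‖ : ℂ) * (toCircle y - τ) *
        szego s (toCircle y))) * ∫ x : UnitAddCircle, fourier (-m) x *
        ((a + c * toCircle y) + (b + d * toCircle y) * (toCircle x : ℂ))⁻¹ ∂haarAddCircle := by
    intro y
    rw [← integral_const_mul]
    refine integral_congr_ae (Filter.Eventually.of_forall fun x => ?_)
    beta_reduce
    rw [pt_mk, fBasis_slice]
    ring
  simp only [hinner]
  rcases lt_or_ge m 0 with hm | hm
  · refine integral_eq_zero_of_ae ?_
    filter_upwards [ae_toCircle_ne τ] with y hy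
    obtain ⟨k, hk⟩ : ∃ k : ℕ, -m = ((k + 1 : ℕ) : ℤ) := ⟨(-m - 1).toNat, by omega⟩
    simp only [hk, fourier_natCast_apply]
    rw [integral_toCircle_pow_mul
      (differentiableAt_inv_affine (h.slice_lt (norm_toCircle y) hy)), mul_zero, Pi.zero_apply]
  · have hn : n < 0 := hmn.resolve_left (by omega)
    obtain ⟨k, hk⟩ : ∃ k : ℕ, -n = ((k + 1 : ℕ) : ℤ) := ⟨(-n - 1).toNat, by omega⟩
    obtain ⟨l, rfl⟩ : ∃ l : ℕ, m = l := ⟨m.toNat, by omega⟩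
    have hd : ∀ z : ℂ, ‖z‖ ≤ 1 → DifferentiableAt ℂ
        (fun z => C * ((Real.sqrt ‖conj a * c - d * conj b‖ : ℂ) * (z - τ) * szego s z) *
          ((-(b + d * z)) ^ l / (a + c * z) ^ (l + 1))) z := by
      intro z hz
      have h1 : DifferentiableAt ℂ (szego s) z :=
        DifferentiableAt.inv (by fun_prop) (one_sub_ne_zero hs hz)
      have h2 : DifferentiableAt ℂ (fun z => (-(b + d * z)) ^ l / (a + c * z) ^ (l + 1)) z :=
        DifferentiableAt.div (by fun_prop) (by fun_prop) (pow_ne_zero _ (affine_ne_zero h.lt hz))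
      fun_prop
    rw [← integral_toCircle_pow_mul hd k]
    refine integral_congr_ae ?_
    filter_upwards [ae_toCircle_ne τ] with y hy
    simp only [hk, fourier_natCast_apply, fourier_neg_natCast_apply]
    rw [integral_conj_pow_mul_inv (h.slice_lt (norm_toCircle y) hy)]
    ring

/-- The function `f / (1 - z₂ conj s)` as an element of `L²`. -/
def kernelElement (h : IsFactor a b c d τ) {s : ℂ} (hs : ‖s‖ < 1) : L2Torus :=
  (memLp_mul_szego (memLp_fBasis h) hs).toLp _

/-- Up to the nonzero scalar `conj (f (0, s))`, this is the reproducing kernel at `w = (0, s)`. -/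
lemma kernelElement_mem (h : IsFactor a b c d τ) {s : ℂ} (hs : ‖s‖ < 1) :
    kernelElement h hs ∈ S₂θ a b c d τ := by
  have hcoe := MemLp.coeFn_toLp (memLp_mul_szego (memLp_fBasis h) hs)
  set C := conj (fBasis a b c d τ (0, s)) with hC
  have hsτ : s ≠ τ := by
    rintro rfl
    exact hs.ne h.norm_tau
  have hC0 : C ≠ 0 := by
    rw [hC, fBasis_slice, mul_zero, add_zero]
    refine (map_ne_zero _).2 (mul_ne_zero (mul_ne_zero ?_ (sub_ne_zero.2 hsτ))
      (inv_ne_zero (affine_ne_zero h.lt hs.le)))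
    simpa using h.kappa
  have hCk : (C • kernelElement h hs : L2Torus) =ᵐ[torusMeasure]
      fun x => C * (fBasis a b c d τ (pt x) * szego s (pt x).2) := by
    filter_upwards [Lp.coeFn_smul C (kernelElement h hs), hcoe] with x h1 h2
    rw [h1, Pi.smul_apply, smul_eq_mul, kernelElement, h2]
  have hmem : C • kernelElement h hs ∈ S₂θ a b c d τ := by
    refine Submodule.le_topologicalClosure _ (Submodule.subset_span
      ⟨mem_hardy_of_ae_eq h hs C hCk, (0, s), by simp, hs, ?_⟩)
    filter_upwards [hCk] with x hx
    rw [hx, szego, hC]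
    ring
  have := (S₂θ a b c d τ).smul_mem C⁻¹ hmem
  rwa [inv_smul_smul₀ hC0] at this

/-! ### The quadratic form of the compressed shift -/

lemma Mz₁_ae_eq (F : L2Torus) : Mz₁ F =ᵐ[torusMeasure] fun x => (pt x).1 * F x := by
  have h1 : Mz₁ F =ᵐ[torusMeasure] fun x =>
      (ContinuousLinearMap.mul ℂ ℂ) ((memLp_z₁.toLp _ : Lp ℂ ⊤ torusMeasure) x) (F x) :=
    ContinuousLinearMap.coeFn_holder _ _ _
  filter_upwards [h1, memLp_z₁.coeFn_toLp] with x hx hx'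
  rw [hx, hx', ContinuousLinearMap.mul_apply']

/-- The elements of `𝓢₂` on which the quadratic form is evaluated. -/
lemma exists_model_element {a b c d τ : Fin 2 → ℂ}
    (h : ∀ j, IsFactor (a j) (b j) (c j) (d j) (τ j)) (v₁ v₂ : ℂ) {s : ℂ} (hs : ‖s‖ < 1) :
    ∃ F ∈ S₂ a b c d τ, F =ᵐ[torusMeasure] fun x =>
      pairFun (a 0) (b 0) (c 0) (d 0) (τ 0) (a 1) (b 1) (c 1) (d 1) (τ 1) v₁ v₂ (pt x) *
        szego s (pt x).2 := by
  have hcoe : ∀ j, kernelElement (h j) hs =ᵐ[torusMeasure] _ := fun j =>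
    MemLp.coeFn_toLp (memLp_mul_szego (memLp_fBasis (h j)) hs)
  have hL : MemLp (fun x : Torus => theta (a 0) (b 0) (c 0) (d 0) (pt x) *
      kernelElement (h 1) hs x) 2 torusMeasure := by
    refine (Lp.memLp (kernelElement (h 1) hs)).of_le_mul (c := 1)
      (measurable_theta.aestronglyMeasurable.mul (Lp.memLp _).1)
      (Filter.Eventually.of_forall fun x => ?_)
    rw [norm_mul]
    gcongr
    exact norm_theta_le (norm_toCircle x.1) (norm_toCircle x.2)
  refine ⟨v₁ • kernelElement (h 0) hs + v₂ • hL.toLp _, ?_, ?_⟩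
  · refine Submodule.le_topologicalClosure _ (Submodule.add_mem_sup
      (Submodule.smul_mem _ _ (kernelElement_mem (h 0) hs)) (Submodule.smul_mem _ _ ?_))
    exact ⟨kernelElement (h 1) hs, kernelElement_mem (h 1) hs, hL.coeFn_toLp⟩
  · filter_upwards [Lp.coeFn_add (v₁ • kernelElement (h 0) hs) (v₂ • hL.toLp _),
      Lp.coeFn_smul v₁ (kernelElement (h 0) hs), Lp.coeFn_smul v₂ (hL.toLp _), hL.coeFn_toLp,
      hcoe 0, hcoe 1] with x h1 h2 h3 h4 h5 h6
    rw [h1, Pi.add_apply, h2, h3, Pi.smul_apply, Pi.smul_apply, h4, h5, h6, pairFun, smul_eq_mul,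
      smul_eq_mul]
    ring

/-- Integrate over `z₁` first: the Szegő factor depends only on `z₂` and comes out of the inner
integral. -/
lemma inner_Mz₁_eq (h : IsFactor a b c d τ) (h' : IsFactor a' b' c' d' τ') (v₁ v₂ s : ℂ)
    {F : L2Torus} (hF : F =ᵐ[torusMeasure] fun x =>
      pairFun a b c d τ a' b' c' d' τ' v₁ v₂ (pt x) * szego s (pt x).2) :
    inner ℂ F (Mz₁ F) = ∫ y : UnitAddCircle, ((‖szego s (toCircle y)‖ ^ 2 : ℝ) : ℂ) *
      symbolForm a b c d τ a' b' c' d' τ' v₁ v₂ (toCircle y) ∂haarAddCircle := by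
  have hae : (fun x : Torus => inner ℂ (F x) (Mz₁ F x)) =ᵐ[torusMeasure] fun x =>
      ((‖szego s (pt x).2‖ ^ 2 : ℝ) : ℂ) * ((pt x).1 *
        (pairFun a b c d τ a' b' c' d' τ' v₁ v₂ (pt x) *
          conj (pairFun a b c d τ a' b' c' d' τ' v₁ v₂ (pt x)))) := by
    filter_upwards [hF, Mz₁_ae_eq F] with x h1 h2
    rw [h2, h1, RCLike.inner_apply, map_mul, Complex.ofReal_pow, ← Complex.mul_conj']
    ring
  rw [L2.inner_def, integral_congr_ae hae]
  refine (integral_prod_symm _ ((L2.integrable_inner F (Mz₁ F)).congr hae)).trans ?_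
  refine integral_congr_ae ?_
  filter_upwards [ae_toCircle_ne τ, ae_toCircle_ne τ'] with y hy hy'
  rw [← integral_slice_pairFun h h' v₁ v₂ (norm_toCircle y) hy hy', ← integral_const_mul]
  rfl

/-- A value of the symbol with positive real part is approximated by the quadratic form of the
compressed shift. -/
lemma exists_inner_compressedShift_re_pos {a b c d τ : Fin 2 → ℂ}
    (h : ∀ j, IsFactor (a j) (b j) (c j) (d j) (τ j)) (u v₁ v₂ : ℂ) {z : ℂ} (hz : ‖z‖ = 1)
    (hpos : 0 < (u * symbolForm (a 0) (b 0) (c 0) (d 0) (τ 0) (a 1) (b 1) (c 1) (d 1) (τ 1)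
      v₁ v₂ z).re) :
    ∃ F : S₂ a b c d τ, 0 < (u * inner ℂ F (compressedShift a b c d τ F)).re := by
  obtain ⟨y₀, rfl⟩ : ∃ y₀ : UnitAddCircle, (toCircle y₀ : ℂ) = z := by
    obtain ⟨y₀, hy₀⟩ := (homeomorphCircle (one_ne_zero' ℝ)).surjective
      ⟨z, mem_sphere_zero_iff_norm.2 hz⟩
    refine ⟨y₀, ?_⟩
    rw [homeomorphCircle_apply] at hy₀
    rw [hy₀]
  -- With `s = r y₀`, the weight `(1 - r²) |szego s|²` is the Poisson kernel at `s`; the positive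
  -- factor `1 - r²` does not affect the sign.
  have hlim := tendsto_integral_poisson (continuous_symbolForm (h 0) (h 1) v₁ v₂) y₀
  have hlim' := ((Complex.continuous_re.comp (continuous_const_mul u)).tendsto _).comp hlim
  obtain ⟨r, hr, hr0, hr1⟩ := ((hlim'.eventually (lt_mem_nhds hpos)).and
    (Ioo_mem_nhdsLT (zero_lt_one' ℝ))).exists
  have hs : ‖(r : ℂ) * toCircle y₀‖ < 1 := by
    rw [norm_mul, norm_toCircle, Complex.norm_real, Real.norm_of_nonneg hr0.le, mul_one]
    exact hr1
  obtain ⟨F, hF, hFae⟩ := exists_model_element h v₁ v₂ hs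
  refine ⟨⟨F, hF⟩, ?_⟩
  rw [compressedShift, inner_compression]
  change 0 < (u * inner ℂ F (Mz₁ F)).re
  have hr2 : 0 < 1 - r ^ 2 := by nlinarith
  have e : ∫ y : UnitAddCircle,
      ((1 - r ^ 2) * ‖(1 - (toCircle y : ℂ) * conj ((r : ℂ) * toCircle y₀))⁻¹‖ ^ 2) •
        symbolForm (a 0) (b 0) (c 0) (d 0) (τ 0) (a 1) (b 1) (c 1) (d 1) (τ 1) v₁ v₂ (toCircle y)
        ∂haarAddCircle = ((1 - r ^ 2 : ℝ) : ℂ) * inner ℂ F (Mz₁ F) := by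
    rw [inner_Mz₁_eq (h 0) (h 1) v₁ v₂ _ hFae, ← integral_const_mul]
    refine integral_congr_ae (Filter.Eventually.of_forall fun y => ?_)
    beta_reduce
    rw [Complex.real_smul, Complex.ofReal_mul, szego, mul_assoc]
  simp only [Function.comp_apply] at hr
  rw [e, mul_left_comm, Complex.re_ofReal_mul] at hr
  exact (mul_pos_iff_of_pos_left hr2).1 hr

end Slices

end BidiskShift

end

/-! ### The theorem -/

open BidiskShift in
theorem proposition5p1
    (a b c d τ₁ τ₂ : Fin 2 → ℂ)
    (hinner : ∀ j, IsInnerOneOne (a j) (b j) (c j) (d j))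
    (hτ₁ : ∀ j, ‖τ₁ j‖ = 1) (hτ₂ : ∀ j, ‖τ₂ j‖ = 1)
    (hzero : ∀ j, pval (a j) (b j) (c j) (d j) (τ₁ j, τ₂ j) = 0)
    (f : Fin 2 → ℂ → ℂ) (hf : ∀ j z, f j z = focus (a j) (b j) (c j) (d j) z)
    (β : Fin 2 → ℂ) (hβ : ∀ j, β j = circleCenter (focusCircle (a j) (b j) (c j) (d j))) :
    ((∃ γ : ℂ, ‖γ‖ = 1 ∧ (∀ j, γ ≠ τ₂ j) ∧
        (‖f 0 γ‖ + ‖f 1 γ‖ < ‖1 - conj (f 0 γ) * f 1 γ‖ ∨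
          ∃ j, ‖conj (β j) - f j γ‖ > ‖conj (β j)‖)) →
      (0 : ℂ) ∈ interior (numericalRange (compressedShift a b c d τ₂))) ∧
    (∀ j, (a j * conj (b j) - c j * conj (d j)).im = 0 →
      ∀ γ : ℂ, ‖γ‖ = 1 → (∀ i, γ ≠ τ₂ i) →
        (‖conj (β j) - f j γ‖ > ‖conj (β j)‖ ↔
          ‖a j * d j - b j * c j‖ > ‖a j * conj (b j) - c j * conj (d j)‖)) := by
  have h : ∀ j, IsFactor (a j) (b j) (c j) (d j) (τ₂ j) := fun j =>
    isFactor (hinner j) (hτ₁ j) (hτ₂ j) (hzero j)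
  simp only [hf, hβ]
  refine ⟨?_, fun j _ γ hγ _ => center_condition_iff (h j).lt (h j).det hγ⟩
  rintro ⟨γ, hγ, -, hcase⟩
  refine zero_mem_interior_numericalRange _ fun u hu => ?_
  rcases hcase with hlt | ⟨j, hj⟩
  · obtain ⟨v₁, v₂, hv⟩ := exists_form_re_pos hu (norm_offDiag_sq (h 0) (h 1) hγ) hlt
    exact exists_inner_compressedShift_re_pos h u v₁ v₂ hγ hv
  -- The slice `z` now depends on the half plane; a coordinate vector `(v₁, v₂)` picks out the focus
  -- of index `j`.
  · obtain ⟨z, hz, hpos⟩ := exists_focus_re_pos (h j).lt (h j).det hγ hj hu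
    fin_cases j
    · exact exists_inner_compressedShift_re_pos h u 1 0 hz (by simpa [symbolForm] using hpos)
    · exact exists_inner_compressedShift_re_pos h u 0 1 hz (by simpa [symbolForm] using hpos)
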